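/- Let $n\ge 1$, let $\mathbb{S}^n$ be the complex vector space of symmetric $n\times n$ matrices, and let $X\subseteq\mathbb{P}(\mathbb{S}^n)$ be an irreducible closed subvariety which is smooth at each of its points outside the hypersurface $V(\det)$. Let $C_X\subseteq\mathbb{S}^n$ be the affine cone over $X$ and $C_X^\circ=\{M\in C_X:\det M\neq 0\}$. For $S\in\mathbb{S}^n$ let \[ \ell_S(M)=\log\det(M)-\operatorname{tr}(SM), \] and let $f_{\det,S}$ be the rational function $M\mapsto \det(M)/\operatorname{tr}(SM)^n$ on $X$, with $D_{\det,S}=\operatorname{Supp}(\operatorname{div}(f_{\det,S}))$. A property holds for generic $S$ if it holds for all $S$ in some nonempty Zariski open subset of $\mathbb{S}^n$. The Gaussian ML degree of $X$ is the number of critical points of $\ell_S|_{C_X^\circ}$ for generic $S$; that is, there is an integer $d\geq 0$ such that for generic $S$ the scheme of critical points of $\ell_S|_{C_X^\circ}$ is reduced and consists of exactly $d$ points (so that counting with or without multiplicity gives the same number), and the Gaussian ML degree of $X$ is this $d$. Then this number $d$ exists, and for generic $S\in\mathbb{S}^n$ the number of critical points of $\log f_{\det,S}$ on $X\setminus D_{\det,S}$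 equals the Gaussian ML degree $d$ of $X$. (Critical points of $\log f_{\det,S}$ are points near which $f_{\det,S}$ is regular without zeros and at which $d\log f_{\det,S}$ vanishes on the Zariski tangent space of $X$. If $X\subseteq V(\det)$, both numbers are $0$.) -/

import Mathlib

open MvPolynomial
open scoped LinearAlgebra.Projectivization

noncomputable section

namespace MLDeg

variable {σ : Type} [Fintype σ]

/-! ### Projective varieties over the complex numbers -/

/-- The closed subset of projective space cut out by a set of homogeneous polynomials. -/
def projZeros (T : Set (MvPolynomial σ ℂ)) : Set (ℙ ℂ (σ → ℂ)) :=
  {p | ∀ g ∈ T, eval p.rep g = 0}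

/-- Zariski closed subsets of projective space. -/
def IsZariskiClosed (Z : Set (ℙ ℂ (σ → ℂ))) : Prop :=
  ∃ T : Set (MvPolynomial σ ℂ), (∀ g ∈ T, ∃ d : ℕ, g.IsHomogeneous d) ∧ Z = projZeros T

/-- A polynomial that is homogeneous of degree `d` satisfies `g (a • x) = a ^ d * g x`. -/
theorem eval_smul_of_isHomogeneous {g : MvPolynomial σ ℂ} {d : ℕ} (hg : g.IsHomogeneous d)
    (a : ℂ) (x : σ → ℂ) : eval (a • x) g = a ^ d * eval x g := by
  rw [eval_eq, eval_eq, Finset.mul_sum]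
  refine Finset.sum_congr rfl fun m hm => ?_
  have hd : m.degree = d := by
    rw [Finsupp.degree_eq_weight_one]
    exact hg (mem_support_iff.mp hm)
  have : ∏ i ∈ m.support, (a • x) i ^ m i = a ^ d * ∏ i ∈ m.support, x i ^ m i := by
    have hs : m.degree = ∑ i ∈ m.support, m i := rfl
    rw [← hd, hs, ← Finset.prod_pow_eq_pow_sum, ← Finset.prod_mul_distrib]
    exact Finset.prod_congr rfl fun i _ => by simp [mul_pow]
  rw [this]
  ring

/-- An irreducible closed subvariety of the projective space with homogeneous coordinates
indexed by `σ`. -/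
structure ProjVariety (σ : Type) [Fintype σ] where
  carrier : Set (ℙ ℂ (σ → ℂ))
  isClosed : IsZariskiClosed carrier
  nonempty : carrier.Nonempty
  irreducible : ∀ Y Z : Set (ℙ ℂ (σ → ℂ)), IsZariskiClosed Y → IsZariskiClosed Z →
    carrier ⊆ Y ∪ Z → carrier ⊆ Y ∨ carrier ⊆ Z

namespace ProjVariety

variable (X : ProjVariety σ)

/-- The affine cone over `X` (it contains the origin). -/
def cone : Set (σ → ℂ) := {x | ∀ hx : x ≠ 0, Projectivization.mk ℂ x hx ∈ X.carrier}

/-- The homogeneous ideal `I(X)`: all polynomials that vanish on the affine cone over `X`. -/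
def ideal : Ideal (MvPolynomial σ ℂ) := vanishingIdeal ℂ X.cone

theorem mem_ideal_iff (g : MvPolynomial σ ℂ) : g ∈ X.ideal ↔ ∀ x ∈ X.cone, eval x g = 0 := by
  simp [ideal, mem_vanishingIdeal_iff, aeval_eq_eval]

theorem smul_mem_cone {x : σ → ℂ} (hx : x ∈ X.cone) (a : ℂ) : a • x ∈ X.cone := by
  intro h
  have hx0 : x ≠ 0 := fun h0 => h (by simp [h0])
  have ha0 : a ≠ 0 := fun h0 => h (by simp [h0])
  have : Projectivization.mk ℂ (a • x) h = Projectivization.mk ℂ x hx0 :=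
    (Projectivization.mk_eq_mk_iff' ℂ _ _ _ _).2 ⟨a, rfl⟩
  rw [this]
  exact hx hx0

theorem rep_mem_cone {p : ℙ ℂ (σ → ℂ)} (hp : p ∈ X.carrier) : p.rep ∈ X.cone := by
  intro h
  rw [Projectivization.mk_rep]
  exact hp

/-- A homogeneous polynomial lies in `I(X)` if and only if it vanishes on `X`. -/
theorem mem_ideal_iff_of_isHomogeneous {g : MvPolynomial σ ℂ} {d : ℕ} (hg : g.IsHomogeneous d) :
    g ∈ X.ideal ↔ X.carrier ⊆ projZeros {g} := by
  rw [mem_ideal_iff]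
  constructor
  · rintro h p hp g' rfl
    exact h _ (X.rep_mem_cone hp)
  · intro h x hx
    have key : ∀ p ∈ X.carrier, eval p.rep g = 0 := fun p hp => h hp g rfl
    by_cases hx0 : x = 0
    · obtain ⟨p, hp⟩ := X.nonempty
      have := eval_smul_of_isHomogeneous hg 0 p.rep
      rw [zero_smul, key p hp, mul_zero] at this
      rw [hx0, this]
    · obtain ⟨a, ha⟩ := Projectivization.exists_smul_eq_mk_rep ℂ x hx0
      have h1 := key _ (hx hx0)
      rw [← ha, Units.smul_def, eval_smul_of_isHomogeneous hg] at h1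
      exact (mul_eq_zero.1 h1).resolve_left (pow_ne_zero _ a.ne_zero)

/-- All homogeneous components of an element of `I(X)` lie in `I(X)`. -/
theorem homogeneousComponent_mem_ideal {g : MvPolynomial σ ℂ} (hg : g ∈ X.ideal) (d : ℕ) :
    homogeneousComponent d g ∈ X.ideal := by
  rw [mem_ideal_iff] at hg ⊢
  intro x hx
  let P : Polynomial ℂ := ∑ i ∈ Finset.range (g.totalDegree + 1),
    Polynomial.monomial i (eval x (homogeneousComponent i g))
  have hP : P = 0 := by
    refine Polynomial.funext fun t => ?_
    have h := hg _ (X.smul_mem_cone hx t)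
    rw [← sum_homogeneousComponent g, map_sum] at h
    simp only [P, Polynomial.eval_finsetSum, Polynomial.eval_monomial, Polynomial.eval_zero]
    rw [← h]
    refine Finset.sum_congr rfl fun i _ => ?_
    rw [eval_smul_of_isHomogeneous (homogeneousComponent_isHomogeneous i g), mul_comm]
  by_cases hd : d < g.totalDegree + 1
  · have h := congrArg (fun Q : Polynomial ℂ => Q.coeff d) hP
    simpa [P, Polynomial.finsetSum_coeff, Polynomial.coeff_monomial, hd] using h
  · rw [homogeneousComponent_eq_zero _ _ (by omega), map_zero]

theorem ideal_isHomogeneous :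
    letI := gradedAlgebra (σ := σ) (R := ℂ)
    X.ideal.IsHomogeneous (homogeneousSubmodule σ ℂ) := by
  let _ := gradedAlgebra (σ := σ) (R := ℂ)
  intro d g hg
  have h := X.homogeneousComponent_mem_ideal hg d
  rw [← decomposition.decompose'_apply] at h
  exact h

instance ideal_isPrime : X.ideal.IsPrime := by
  let _ := gradedAlgebra (σ := σ) (R := ℂ)
  refine X.ideal_isHomogeneous.isPrime_of_homogeneous_mem_or_mem ?_ ?_
  · intro h
    obtain ⟨p, hp⟩ := X.nonempty
    have h1 : (1 : MvPolynomial σ ℂ) ∈ X.ideal := h ▸ Submodule.mem_top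
    have := (X.mem_ideal_iff 1).1 h1 _ (X.rep_mem_cone hp)
    simp at this
  · rintro g g' ⟨d, hg⟩ ⟨e, hg'⟩ hgg'
    have hg : g.IsHomogeneous d := hg
    have hg' : g'.IsHomogeneous e := hg'
    rw [X.mem_ideal_iff_of_isHomogeneous hg, X.mem_ideal_iff_of_isHomogeneous hg']
    refine X.irreducible _ _ ⟨{g}, ?_, rfl⟩ ⟨{g'}, ?_, rfl⟩ ?_
    · rintro _ rfl; exact ⟨d, hg⟩
    · rintro _ rfl; exact ⟨e, hg'⟩
    · intro p hp
      have := (X.mem_ideal_iff _).1 hgg' _ (X.rep_mem_cone hp)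
      rw [map_mul] at this
      rcases mul_eq_zero.1 this with h | h
      · left; rintro _ rfl; exact h
      · right; rintro _ rfl; exact h

/-! ### Tangent spaces and smoothness -/

/-- The differential at `x` of the polynomial function `g`, a linear form on `σ → ℂ`. -/
def differential (g : MvPolynomial σ ℂ) (x : σ → ℂ) : (σ → ℂ) →ₗ[ℂ] ℂ :=
  ∑ i, eval x (pderiv i g) • LinearMap.proj i

/-- The Zariski tangent space at `x` of the affine cone over `X`. -/
def coneTangentSpace (x : σ → ℂ) : Submodule ℂ (σ → ℂ) :=
  ⨅ g ∈ X.ideal, LinearMap.ker (differential g x)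

/-- The homogeneous coordinate ring of `X`. -/
abbrev coordRing : Type := MvPolynomial σ ℂ ⧸ X.ideal

/-- `X` is smooth at `p = [x]` (Jacobian criterion). For `x ≠ 0` the tangent space of the cone at
`x` is one dimension larger than the tangent space of `X` at `[x]`, and the dimension of the cone
(the Krull dimension of the homogeneous coordinate ring) is the dimension of `X` plus one. -/
def SmoothAt (p : ℙ ℂ (σ → ℂ)) : Prop :=
  ((Module.finrank ℂ (X.coneTangentSpace p.rep) : ℕ) : WithBot ℕ∞) = ringKrullDim X.coordRing

/-- `X` is smooth away from the hypersurface `V(F)`, for a homogeneous polynomial `F`. -/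
def SmoothAwayFrom (F : MvPolynomial σ ℂ) : Prop :=
  ∀ p ∈ X.carrier, eval p.rep F ≠ 0 → X.SmoothAt p

/-! ### Critical points of `log F - η` on the affine cone -/

/-- The critical points of the restriction of `log F - η` to the part of the affine cone over `X`
where `F ≠ 0`: the points where the differential `dF / F - dη` vanishes on the tangent space. -/
def critLogMinus (F η : MvPolynomial σ ℂ) : Set (σ → ℂ) :=
  {x | x ∈ X.cone ∧ eval x F ≠ 0 ∧
    ∀ v ∈ X.coneTangentSpace x, differential F x v / eval x F - differential η x v = 0}

/-- The coordinate ring `ℂ[x, 1/F] / I(X)` of the part of the affine cone where `F ≠ 0`. -/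
abbrev openConeRing (F : MvPolynomial σ ℂ) : Type :=
  Localization.Away (Ideal.Quotient.mk X.ideal F)

/-- The class of a polynomial in the coordinate ring of the open part of the cone. -/
def toOpenConeRing (F : MvPolynomial σ ℂ) (g : MvPolynomial σ ℂ) : X.openConeRing F :=
  algebraMap X.coordRing (X.openConeRing F) (Ideal.Quotient.mk X.ideal g)

/-- The ideal of the scheme of zeros of the differential form `F⁻¹ dF - dη` on the (smooth) open
part of the cone: it is generated by the contractions of this form with all vector fields. -/
def critIdeal (F η : MvPolynomial σ ℂ) : Ideal (X.openConeRing F) :=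
  Ideal.span (Set.range fun δ : Derivation ℂ (X.openConeRing F) (X.openConeRing F) =>
    IsLocalization.Away.invSelf (Ideal.Quotient.mk X.ideal F) * δ (X.toOpenConeRing F F)
      - δ (X.toOpenConeRing F η))

/-- The coordinate ring of the scheme of critical points of `log F - η` on the open part of the
cone. -/
abbrev critRing (F η : MvPolynomial σ ℂ) : Type := X.openConeRing F ⧸ X.critIdeal F η

/-! ### Rational functions, their divisors, and critical points of their logarithms -/

/-- The fraction field of the homogeneous coordinate ring. The function field of `X` consists of
its elements `a / b` with `a`, `b` homogeneous of the same degree. -/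
abbrev coneField : Type := FractionRing X.coordRing

/-- The class of a polynomial in the fraction field of the homogeneous coordinate ring. -/
def toConeField : MvPolynomial σ ℂ →+* X.coneField :=
  (algebraMap X.coordRing X.coneField).comp (Ideal.Quotient.mk X.ideal)

theorem toConeField_eq_zero_iff (g : MvPolynomial σ ℂ) : X.toConeField g = 0 ↔ g ∈ X.ideal := by
  rw [toConeField, RingHom.comp_apply,
    map_eq_zero_iff _ (IsFractionRing.injective X.coordRing X.coneField),
    Ideal.Quotient.eq_zero_iff_mem]

/-- For `Z ⊆ X` we have `I(X) ⊆ I(Z)`. -/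
theorem ideal_mono {Z : ProjVariety σ} (h : Z.carrier ⊆ X.carrier) : X.ideal ≤ Z.ideal :=
  vanishingIdeal_anti_mono fun _ hx h0 => h (hx h0)

/-- The local ring of `X` along a closed subvariety `Z ⊆ X`, as a subring of the function field:
all `a / b` with `a`, `b` homogeneous of the same degree and `b` not identically zero on `Z`. -/
def localRing (Z : ProjVariety σ) (h : Z.carrier ⊆ X.carrier) : Subring X.coneField where
  carrier := {f | ∃ (d : ℕ) (a b : MvPolynomial σ ℂ), a.IsHomogeneous d ∧ b.IsHomogeneous d ∧
    b ∉ Z.ideal ∧ f = X.toConeField a / X.toConeField b}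
  zero_mem' := ⟨0, 0, 1, isHomogeneous_zero _ _ _, isHomogeneous_one _ _,
    fun h1 => Z.ideal_isPrime.ne_top ((Ideal.eq_top_iff_one _).2 h1), by simp⟩
  one_mem' := ⟨0, 1, 1, isHomogeneous_one _ _, isHomogeneous_one _ _,
    fun h1 => Z.ideal_isPrime.ne_top ((Ideal.eq_top_iff_one _).2 h1), by simp⟩
  add_mem' := by
    rintro _ _ ⟨d, a, b, ha, hb, hbZ, rfl⟩ ⟨e, a', b', ha', hb', hbZ', rfl⟩
    have h1 : X.toConeField b ≠ 0 := fun h0 =>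
      hbZ (X.ideal_mono h ((X.toConeField_eq_zero_iff b).1 h0))
    have h2 : X.toConeField b' ≠ 0 := fun h0 =>
      hbZ' (X.ideal_mono h ((X.toConeField_eq_zero_iff b').1 h0))
    refine ⟨d + e, a * b' + b * a', b * b', (ha.mul hb').add (hb.mul ha'), hb.mul hb',
      fun h0 => (Z.ideal_isPrime.mem_or_mem h0).elim hbZ hbZ', ?_⟩
    rw [div_add_div _ _ h1 h2]
    simp
  mul_mem' := by
    rintro _ _ ⟨d, a, b, ha, hb, hbZ, rfl⟩ ⟨e, a', b', ha', hb', hbZ', rfl⟩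
    refine ⟨d + e, a * a', b * b', ha.mul ha', hb.mul hb',
      fun h0 => (Z.ideal_isPrime.mem_or_mem h0).elim hbZ hbZ', ?_⟩
    rw [div_mul_div_comm]
    simp
  neg_mem' := by
    rintro _ ⟨d, a, b, ha, hb, hbZ, rfl⟩
    exact ⟨d, -a, b, ha.neg, hb, hbZ, by simp [neg_div]⟩

/-- `Z` is a prime divisor of `X`: a closed irreducible subvariety of codimension one. -/
def IsPrimeDivisor (Z : ProjVariety σ) : Prop :=
  Z.carrier ⊆ X.carrier ∧ (Z.ideal.map (Ideal.Quotient.mk X.ideal)).height = 1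

/-- The order of the rational function `f` along `Z` is not zero. Here the order of `f = a / b`,
with nonzero `a`, `b` in the local ring of `X` along `Z`, is the difference of the orders of
`a` and `b`, where the order of `a` is the length of the local ring modulo `a`. -/
def HasNonzeroOrder (Z : ProjVariety σ) (h : Z.carrier ⊆ X.carrier) (f : X.coneField) : Prop :=
  ∃ a b : X.localRing Z h, a ≠ 0 ∧ b ≠ 0 ∧ f = (a : X.coneField) / (b : X.coneField) ∧
    Ring.ord (X.localRing Z h) a ≠ Ring.ord (X.localRing Z h) b

/-- The support of the divisor of a rational function `f` on `X`: the union of the prime divisors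
along which the order of `f` is not zero. -/
def divSupport (f : X.coneField) : Set (ℙ ℂ (σ → ℂ)) :=
  {p | ∃ (Z : ProjVariety σ) (h : X.IsPrimeDivisor Z), X.HasNonzeroOrder Z h.1 f ∧ p ∈ Z.carrier}

/-- `p = [x]` is a critical point of `log f`, for a rational function `f` on `X`: near `p` the
function `f` is regular without zeros, that is `f = a / b` with `a`, `b` homogeneous of the same
degree and `a x ≠ 0`, `b x ≠ 0`, and `d log f = da / a - db / b` vanishes on the tangent space. -/
def IsCritLog (f : X.coneField) (p : ℙ ℂ (σ → ℂ)) : Prop :=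
  p ∈ X.carrier ∧ ∃ (d : ℕ) (a b : MvPolynomial σ ℂ), a.IsHomogeneous d ∧ b.IsHomogeneous d ∧
    f = X.toConeField a / X.toConeField b ∧ eval p.rep a ≠ 0 ∧ eval p.rep b ≠ 0 ∧
    ∀ v ∈ X.coneTangentSpace p.rep,
      differential a p.rep v / eval p.rep a - differential b p.rep v / eval p.rep b = 0

end ProjVariety

/-! ### Symmetric matrices -/

/-- The symmetric matrix with entries `x_{ij} = x_{ji}`. The coordinates of the space of complex
symmetric `n × n` matrices are indexed by unordered pairs of indices. -/
def symMatrix {n : ℕ} {R : Type*} (x : Sym2 (Fin n) → R) : Matrix (Fin n) (Fin n) R :=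
  Matrix.of fun i j => x s(i, j)

/-- Every symmetric matrix is `symMatrix x` for exactly one `x`. -/
theorem existsUnique_symMatrix_eq {n : ℕ} {R : Type*} (M : Matrix (Fin n) (Fin n) R)
    (hM : M.IsSymm) : ∃! x : Sym2 (Fin n) → R, symMatrix x = M := by
  refine ⟨Sym2.lift ⟨fun i j => M i j, fun i j => hM.apply j i⟩, ?_, fun y hy => ?_⟩
  · ext i j
    simp [symMatrix]
  · funext z
    induction z using Sym2.ind with
    | _ i j => simp [← hy, symMatrix]

theorem symMatrix_isSymm {n : ℕ} {R : Type*} (x : Sym2 (Fin n) → R) : (symMatrix x).IsSymm := by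
  ext i j
  simp [symMatrix, Sym2.eq_swap]

/-- The determinant, as a polynomial function on symmetric `n × n` matrices. -/
def detPoly (n : ℕ) : MvPolynomial (Sym2 (Fin n)) ℂ := (symMatrix X).det

/-- The linear form `M ↦ tr (S M)` on symmetric matrices. -/
def traceForm {n : ℕ} (S : Sym2 (Fin n) → ℂ) : MvPolynomial (Sym2 (Fin n)) ℂ :=
  ((symMatrix S).map (C (σ := Sym2 (Fin n))) * symMatrix X).trace

/-- `P S` holds for generic `S`: for all `S` in a nonempty Zariski open set. -/
def ForGeneric (P : (σ → ℂ) → Prop) : Prop :=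
  ∃ h : MvPolynomial σ ℂ, h ≠ 0 ∧ ∀ S : σ → ℂ, eval S h ≠ 0 → P S

/-- `d` is the Gaussian maximum likelihood degree of `X`: for generic `S` the Gaussian log
likelihood function `log det M - tr (S M)` on the invertible part of the affine cone over `X` has
exactly `d` critical points, and its scheme of critical points is reduced (so that `d` is also the
number of critical points counted with multiplicity). -/
def IsGaussianMLDegree {n : ℕ} (X : ProjVariety (Sym2 (Fin n))) (d : ℕ) : Prop :=
  ForGeneric fun S : Sym2 (Fin n) → ℂ =>
    (X.critLogMinus (detPoly n) (traceForm S)).encard = d ∧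
    IsReduced (X.critRing (detPoly n) (traceForm S))

/-- The rational function `det M / tr (S M) ^ n` on `X`. -/
def gaussianRatFun {n : ℕ} (X : ProjVariety (Sym2 (Fin n))) (S : Sym2 (Fin n) → ℂ) :
    X.coneField :=
  X.toConeField (detPoly n) / X.toConeField (traceForm S ^ n)

end MLDeg

end

/-!
The two counts are compared by rescaling. By Euler's identity the point `x` itself is tangent to
the cone at `x`, so `tr (S x) = n` at every critical point `x` of `log det - tr (S ·)` on the cone.
Conversely, the condition for a critical point of `log (det / tr (S ·) ^ n)` is invariant under
rescaling, and on the slice `tr (S x) = n` it is the condition for `log det - tr (S ·)`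
(`mem_critLogMinus_iff`, `encard_isCritQuotient`). It remains to see that critical points of
the rational function lie off `V(det)`. If `tr (S ·)` vanishes on no component of `X ∩ V(det)`, as
holds for generic `S`, then near a point of `X ∩ V(det)` the rational function is not a unit
(`IsCritLog.eval_ne_zero`). Off `V(det)` and off `V(tr (S ·))` it is a unit, so these points do
not lie in the support of its divisor (`notMem_divSupport`).

That the number of critical points on the cone is finite and generically constant is shown on the
incidence variety of pairs `(x, S)` such that `x` is critical for `S`. Let `A` be the coordinate
ring of the part of the cone with `det ≠ 0`. The incidence variety is the spectrum of
`A[S] / J`, where `J` is generated by one equation, affine in `S`, for each derivation of `A`, and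
the scheme of critical points for `S` is exactly its fibre over `S`. Smoothness yields local
coordinates `x b`, `b ∈ I`, on the cone with dual derivations (`SmoothCone.exists_isFrame`, by
Cramer's rule). So the equations can locally be solved for the variables `S b`, `b ∈ I`; the
incidence variety is locally the product of the cone with an affine space, hence irreducible
(`HasFrames.isPrime_incidenceIdeal`), and its dimension is at most that of the space of all `S`
(`HasFrames.trdeg_le`). If its projection to the space of all `S` is dominant, then it is
generically finite, and in characteristic zero a primitive element shows that the generic fibres
are reduced with the same number of points (`exists_card_fibre_of_isAlgebraic`). Otherwise the
generic fibre is empty.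
-/

noncomputable section

namespace MLDeg

/-! ### Generic fibres of generically finite extensions -/

section GenericFibre

open Polynomial

variable {R B : Type*} [CommRing R] [CommRing B] [IsDomain B] [Algebra R B]

/-- Every element of the fraction field of `B` can be written with a denominator in `R`. -/
theorem exists_smul_mem_range_of_isAlgebraic [FaithfulSMul R B] [Algebra.IsAlgebraic R B]
    (z : FractionRing B) :
    ∃ r : R, r ≠ 0 ∧ ∃ b : B, algebraMap B (FractionRing B) b = r • z := by
  obtain ⟨b₀, b₁, hb₁, rfl⟩ := IsFractionRing.div_surjective B z
  have hb₁0 : b₁ ≠ 0 := nonZeroDivisors.ne_zero hb₁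
  obtain ⟨r, hr, c, hc⟩ := (Algebra.IsAlgebraic.isAlgebraic (R := R) b₁).exists_nonzero_dvd
    (mem_nonZeroDivisors_of_ne_zero hb₁0)
  refine ⟨r, hr, c * b₀, ?_⟩
  have h1 : algebraMap B (FractionRing B) b₁ ≠ 0 := by
    simpa using hb₁0
  rw [Algebra.smul_def, IsScalarTower.algebraMap_apply R B (FractionRing B), hc]
  field_simp
  simp
  ring

open Classical in
/-- An integral primitive element `θ` for the extension of fraction fields. The denominators needed
to write the elements of the finitely generated algebra `B` as polynomials in `θ` are powers of one
element `a`, and `e` is a denominator for the separability of the minimal polynomial of `θ`. -/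
theorem exists_integral_generator [IsDomain R] [CharZero R] [IsIntegrallyClosed R] [FaithfulSMul R B]
    [Algebra.FiniteType R B] [Algebra.IsAlgebraic R B] :
    ∃ (θ : B) (a e : R) (U V : R[X]), a ≠ 0 ∧ e ≠ 0 ∧ IsIntegral R θ ∧
      U * minpoly R θ + V * derivative (minpoly R θ) = Polynomial.C e ∧
      ∀ b : B, ∃ (N : ℕ) (Q : R[X]), a ^ N • b = Polynomial.aeval θ Q := by
  set K := FractionRing R with hKdef
  set L := FractionRing B with hLdef
  let _ : Algebra K L := FractionRing.liftAlgebra R L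
  have hK0 : CharZero K := charZero_of_injective_algebraMap (IsFractionRing.injective R K)
  have : Algebra.IsAlgebraic B L := IsLocalization.isAlgebraic L (nonZeroDivisors B)
  have : Algebra.IsAlgebraic R L := .trans R B L
  have : Algebra.IsAlgebraic K L :=
    (IsFractionRing.comap_isAlgebraic_iff (A := R) (K := K) (C := L)).1 inferInstance
  have : Algebra.EssFiniteType B L := .of_isLocalization L (nonZeroDivisors B)
  have : Algebra.EssFiniteType R L := .comp R B L
  have : Algebra.EssFiniteType K L := .of_comp R K L
  have : FiniteDimensional K L := Algebra.finite_of_essFiniteType_of_isAlgebraic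
  have hinjBL := IsFractionRing.injective B L
  obtain ⟨z, hz⟩ := Field.exists_primitive_element K L
  obtain ⟨r, hr, b, hb⟩ := exists_smul_mem_range_of_isAlgebraic (R := R) z
  obtain ⟨y, hy, hint⟩ := (Algebra.IsAlgebraic.isAlgebraic (R := R) b).exists_integral_multiple
  set θ : B := y • b with hθ
  have hθL : algebraMap B L θ = (algebraMap R K (y * r)) • z := by
    rw [hθ, Algebra.smul_def, map_mul, hb, ← IsScalarTower.algebraMap_apply,
      Algebra.smul_def, Algebra.smul_def, ← IsScalarTower.algebraMap_apply, map_mul, mul_assoc]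
  have hyr : algebraMap R K (y * r) ≠ 0 := by
    simpa using ⟨hy, hr⟩
  have hprim : IntermediateField.adjoin K {algebraMap B L θ} = ⊤ := by
    rw [eq_top_iff, ← hz, IntermediateField.adjoin_simple_le_iff]
    have h1 : z = (algebraMap R K (y * r))⁻¹ • algebraMap B L θ := by
      rw [hθL, smul_smul, inv_mul_cancel₀ hyr, one_smul]
    rw [h1]
    exact (IntermediateField.adjoin K {algebraMap B L θ}).smul_mem
      (IntermediateField.mem_adjoin_simple_self K _)
  have hintL : IsIntegral R (algebraMap B L θ) := hint.algebraMap
  have hminL : minpoly R (algebraMap B L θ) = minpoly R θ :=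
    minpoly.algebraMap_eq hinjBL θ
  have hminK : minpoly K (algebraMap B L θ) = (minpoly R θ).map (algebraMap R K) := by
    rw [← hminL]; exact minpoly.isIntegrallyClosed_eq_field_fractions' K hintL
  -- clear the denominators in the Bézout identity for the minimal polynomial and its derivative
  obtain ⟨u, v, huv⟩ : (minpoly K (algebraMap B L θ)).Separable :=
    Algebra.IsSeparable.isSeparable K _
  obtain ⟨eu, heu, hu⟩ := IsLocalization.integerNormalization_spec (nonZeroDivisors R) u
  obtain ⟨ev, hev, hv⟩ := IsLocalization.integerNormalization_spec (nonZeroDivisors R) v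
  set U := IsLocalization.integerNormalization (nonZeroDivisors R) u
  set V := IsLocalization.integerNormalization (nonZeroDivisors R) v
  have hU : U.map (algebraMap R K) = Polynomial.C (algebraMap R K eu) * u := by
    rw [hu]; ext; simp [Algebra.smul_def]
  have hV : V.map (algebraMap R K) = Polynomial.C (algebraMap R K ev) * v := by
    rw [hv]; ext; simp [Algebra.smul_def]
  have hden : ∀ b : B, ∃ c : R, c ≠ 0 ∧ ∃ Q : R[X], c • b = Polynomial.aeval θ Q := by
    intro b
    have hmem : algebraMap B L b ∈ Algebra.adjoin K {algebraMap B L θ} := by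
      rw [← IntermediateField.adjoin_simple_toSubalgebra_of_isAlgebraic
        (Algebra.IsAlgebraic.isAlgebraic (R := K) (algebraMap B L θ)), hprim]
      trivial
    rw [Algebra.adjoin_singleton_eq_range_aeval] at hmem
    obtain ⟨q, hq⟩ := hmem
    obtain ⟨c, hc, hcq⟩ := IsLocalization.integerNormalization_spec (nonZeroDivisors R) q
    refine ⟨c, nonZeroDivisors.ne_zero hc,
      IsLocalization.integerNormalization (nonZeroDivisors R) q, hinjBL ?_⟩
    rw [← Polynomial.aeval_algebraMap_apply, ← Polynomial.aeval_map_algebraMap K, hcq]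
    have : c • q = Polynomial.C (algebraMap R K c) * q := by
      ext; simp [Algebra.smul_def]
    rw [this, map_mul, Polynomial.aeval_C]
    change _ = _ * (Polynomial.aeval (algebraMap B L θ)).toRingHom q
    rw [hq, Algebra.smul_def, map_mul, ← IsScalarTower.algebraMap_apply,
      ← IsScalarTower.algebraMap_apply]
  choose c hc0 Q hQ using hden
  obtain ⟨t, ht⟩ := (inferInstance : Algebra.FiniteType R B).out
  refine ⟨θ, ∏ b ∈ t, c b, eu * ev, Polynomial.C ev * U, Polynomial.C eu * V,
    Finset.prod_ne_zero_iff.2 fun b _ => hc0 b,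
    mul_ne_zero (nonZeroDivisors.ne_zero heu) (nonZeroDivisors.ne_zero hev), hint, ?_, ?_⟩
  · apply Polynomial.map_injective _ (IsFractionRing.injective R K)
    rw [hminK, Polynomial.derivative_map] at huv
    simp only [Polynomial.map_add, Polynomial.map_mul, Polynomial.map_C, hU, hV, map_mul]
    linear_combination
      Polynomial.C (algebraMap R K eu) * Polynomial.C (algebraMap R K ev) * huv
  · intro b
    have hb : b ∈ Algebra.adjoin R (t : Set B) := ht ▸ trivial
    induction hb using Algebra.adjoin_induction with
    | mem x hx =>
      refine ⟨1, Polynomial.C (∏ b ∈ t.erase x, c b) * Q x, ?_⟩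
      rw [pow_one, map_mul, ← hQ, Polynomial.aeval_C, ← Finset.mul_prod_erase t c hx]
      simp only [Algebra.smul_def, map_mul]
      ring
    | algebraMap r => exact ⟨0, Polynomial.C r, by simp⟩
    | add x y _ _ hx hy =>
      obtain ⟨N, q, h⟩ := hx
      obtain ⟨N', q', h'⟩ := hy
      refine ⟨N + N', Polynomial.C ((∏ b ∈ t, c b) ^ N') * q +
        Polynomial.C ((∏ b ∈ t, c b) ^ N) * q', ?_⟩
      simp only [map_add, map_mul, ← h, ← h', Polynomial.aeval_C, Algebra.smul_def, map_pow,
        pow_add]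
      ring
    | mul x y _ _ hx hy =>
      obtain ⟨N, q, h⟩ := hx
      obtain ⟨N', q', h'⟩ := hy
      refine ⟨N + N', q * q', ?_⟩
      simp only [map_mul, ← h, ← h', Algebra.smul_def, map_pow, pow_add]
      ring

/-- Generic fibres of a generically finite extension in characteristic zero are reduced and have
the same number of points. The ring `C` is the fibre over the point `s`: away from finitely many
denominators it is `ℂ[X]` modulo the specialized minimal polynomial of a primitive element, which
is separable. -/
theorem exists_card_fibre_of_isAlgebraic [IsDomain R] [CharZero R] [IsIntegrallyClosed R] [FaithfulSMul R B]
    [Algebra.FiniteType R B] [Algebra.IsAlgebraic R B] :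
    ∃ (d : ℕ) (h : R), h ≠ 0 ∧ ∀ s : R →+* ℂ, Function.Surjective s → s h ≠ 0 →
      ∀ (C : Type) [CommRing C] [Algebra ℂ C] (π : B →+* C), Function.Surjective π →
      (∀ r, π (algebraMap R B r) = algebraMap ℂ C (s r)) →
      (∀ b, π b = 0 → b ∈ (RingHom.ker s).map (algebraMap R B)) →
      IsReduced C ∧ ENat.card (C →ₐ[ℂ] ℂ) = d := by
  obtain ⟨θ, a, e, U, V, ha, he, hint, hUV, hden⟩ := exists_integral_generator (R := R) (B := B)
  set P := minpoly R θ with hP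
  have hmonic : P.Monic := minpoly.monic hint
  refine ⟨P.natDegree, a * e, mul_ne_zero ha he, fun s hs hsh C _ _ π hπ hπs hker => ?_⟩
  rw [map_mul] at hsh
  have hsa := left_ne_zero_of_mul hsh
  have hse := right_ne_zero_of_mul hsh
  have hPsep : (P.map s).Separable := by
    refine ⟨Polynomial.C (s e)⁻¹ * U.map s, Polynomial.C (s e)⁻¹ * V.map s, ?_⟩
    have h1 := congrArg (Polynomial.map s) hUV
    simp only [Polynomial.map_add, Polynomial.map_mul, Polynomial.map_C] at h1
    rw [Polynomial.derivative_map, mul_assoc, mul_assoc, ← mul_add, h1, ← Polynomial.C_mul,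
      inv_mul_cancel₀ hse, Polynomial.C_1]
  have hev : ∀ Q : R[X], π (Polynomial.aeval θ Q) = Polynomial.aeval (π θ) (Q.map s) := by
    intro Q
    rw [Polynomial.aeval_def, Polynomial.hom_eval₂, Polynomial.aeval_def, Polynomial.eval₂_map]
    congr 1
    exact RingHom.ext hπs
  let φ : ℂ[X] →ₐ[ℂ] C := Polynomial.aeval (π θ)
  have hφ : Function.Surjective φ := by
    intro y
    obtain ⟨b, rfl⟩ := hπ y
    obtain ⟨N, Q, hQ⟩ := hden b
    refine ⟨Polynomial.C ((s a ^ N)⁻¹) * Q.map s, ?_⟩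
    have h1 := congrArg π hQ
    rw [hev, Algebra.smul_def, map_mul, hπs, map_pow] at h1
    rw [map_mul]
    change _ * (Polynomial.aeval (π θ)) (Q.map s) = _
    rw [← h1]
    change (Polynomial.aeval (π θ)) _ * _ = _
    rw [Polynomial.aeval_C, ← mul_assoc, ← map_mul, inv_mul_cancel₀ (pow_ne_zero _ hsa), map_one,
      one_mul]
  have hPφ : φ (P.map s) = 0 := by
    change Polynomial.aeval (π θ) (P.map s) = 0
    rw [← hev, minpoly.aeval, map_zero]
  -- the minimal polynomial is monic over the integrally closed ring `R`, so it divides every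
  -- relation of `θ` over `R`, and this is preserved by specialization
  have hφker : ∀ G : ℂ[X], φ G = 0 → P.map s ∣ G := by
    intro G hG
    obtain ⟨G', rfl⟩ := Polynomial.map_surjective s hs G
    have h1 := hker (Polynomial.aeval θ G') (by rw [hev]; exact hG)
    -- an element of the extended ideal is, up to a power of `a`, a polynomial in `θ` with
    -- coefficients in the kernel of `s`
    have key : ∀ b ∈ (RingHom.ker s).map (algebraMap R B), ∃ (N : ℕ) (Q : R[X]),
        a ^ N • b = Polynomial.aeval θ Q ∧ Q.map s = 0 := by
      intro b hb
      induction hb using Submodule.span_induction with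
      | mem x hx =>
        obtain ⟨r, hr, rfl⟩ := hx
        exact ⟨0, Polynomial.C r, by simp, by simpa using hr⟩
      | zero => exact ⟨0, 0, by simp, by simp⟩
      | add x y _ _ hx hy =>
        obtain ⟨N, q, h, h0⟩ := hx
        obtain ⟨N', q', h', h0'⟩ := hy
        refine ⟨N + N', Polynomial.C (a ^ N') * q + Polynomial.C (a ^ N) * q', ?_, ?_⟩
        · simp only [map_add, map_mul, ← h, ← h', Polynomial.aeval_C, Algebra.smul_def, map_pow,
            pow_add]
          ring
        · simp [h0, h0']
      | smul y x _ hx =>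
        obtain ⟨N, q, h, h0⟩ := hx
        obtain ⟨N', q', h'⟩ := hden y
        refine ⟨N' + N, q' * q, ?_, by simp [h0]⟩
        rw [map_mul, ← h, ← h', smul_eq_mul, smul_mul_smul_comm, pow_add]
    obtain ⟨N, Q, hQ, hQ0⟩ := key _ h1
    have h2 : Polynomial.aeval θ (Polynomial.C (a ^ N) * G' - Q) = 0 := by
      rw [map_sub, map_mul, ← hQ, Polynomial.aeval_C, Algebra.smul_def, sub_self]
    have h3 := Polynomial.map_dvd s (minpoly.isIntegrallyClosed_dvd hint h2)
    rw [Polynomial.map_sub, hQ0, sub_zero, Polynomial.map_mul, Polynomial.map_C, map_pow] at h3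
    refine ((IsUnit.dvd_mul_left ?_).1 h3)
    exact Polynomial.isUnit_C.2 (IsUnit.mk0 _ (pow_ne_zero _ hsa))
  refine ⟨⟨fun c hc => ?_⟩, ?_⟩
  · obtain ⟨k, hk⟩ := hc
    obtain ⟨G, rfl⟩ := hφ c
    rw [← map_pow] at hk
    obtain ⟨T, hT⟩ := (hPsep.squarefree.isRadical k G (hφker _ hk))
    rw [hT, map_mul, hPφ, zero_mul]
  · have hroot : ∀ f : C →ₐ[ℂ] ℂ, f (π θ) ∈ (P.map s).rootSet ℂ := by
      intro f
      rw [Polynomial.mem_rootSet]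
      refine ⟨(hmonic.map s).ne_zero, ?_⟩
      rw [Polynomial.aeval_algHom_apply]
      exact (congrArg f hPφ).trans (map_zero f)
    let Φ : (C →ₐ[ℂ] ℂ) → (P.map s).rootSet ℂ := fun f => ⟨f (π θ), hroot f⟩
    have hΦ : Function.Bijective Φ := by
      constructor
      · intro f g hfg
        have hfg' : f (π θ) = g (π θ) := congrArg Subtype.val hfg
        refine AlgHom.ext fun c => ?_
        obtain ⟨G, rfl⟩ := hφ c
        change f (Polynomial.aeval (π θ) G) = g (Polynomial.aeval (π θ) G)
        rw [← Polynomial.aeval_algHom_apply, ← Polynomial.aeval_algHom_apply, hfg']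
      · rintro ⟨z, hz⟩
        have hz' := (Polynomial.mem_rootSet.1 hz).2
        have hlift : ∀ G : ℂ[X], G ∈ RingHom.ker φ → Polynomial.aeval z G = 0 := by
          intro G hG
          obtain ⟨T, rfl⟩ := hφker G hG
          rw [map_mul, hz', zero_mul]
        let f : C →ₐ[ℂ] ℂ := (Ideal.Quotient.liftₐ (RingHom.ker φ) (Polynomial.aeval z) hlift).comp
          (Ideal.quotientKerAlgEquivOfSurjective hφ).symm.toAlgHom
        refine ⟨f, Subtype.ext ?_⟩
        change f (π θ) = z
        have h1 : (Ideal.quotientKerAlgEquivOfSurjective hφ).symm (π θ) =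
            Ideal.Quotient.mk _ Polynomial.X := by
          rw [AlgEquiv.symm_apply_eq]
          change _ = φ Polynomial.X
          exact (Polynomial.aeval_X (π θ)).symm
        change (Ideal.Quotient.liftₐ (RingHom.ker φ) (Polynomial.aeval z) hlift)
          ((Ideal.quotientKerAlgEquivOfSurjective hφ).symm (π θ)) = z
        rw [h1]
        exact (Ideal.Quotient.liftₐ_apply _ _ _ _).trans (Polynomial.aeval_X z)
    rw [ENat.card_congr (Equiv.ofBijective Φ hΦ), ENat.card_eq_coe_fintype_card,
      Polynomial.card_rootSet_eq_natDegree hPsep (IsAlgClosed.splits _),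
      hmonic.natDegree_map s]

end GenericFibre

/-! ### The incidence variety of one-forms and their zeros -/

section CriticalEquations

open KaehlerDifferential

variable {σ : Type} {A : Type} [CommRing A] [Algebra ℂ A]

/-- The derivations `δ b`, for `b ∈ I`, are dual to the coordinates `x b` up to the factor `m`, and
after inverting `m` the differentials `d (x b)` generate the module of differentials. So `x b`,
`b ∈ I`, are local coordinates on the smooth scheme `Spec A[1/m]`. -/
structure IsFrame (x : σ → A) (m : A) (I : Finset σ) (δ : σ → Derivation ℂ A A) : Prop where
  apply_self : ∀ b ∈ I, δ b (x b) = m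
  apply_of_ne : ∀ b ∈ I, ∀ c ∈ I, b ≠ c → δ b (x c) = 0
  smul_D : ∀ y, m • D ℂ A y = ∑ b ∈ I, δ b y • D ℂ A (x b)

theorem IsFrame.smul_apply {x : σ → A} {m : A} {I : Finset σ} {δ : σ → Derivation ℂ A A}
    (hI : IsFrame x m I δ) {M : Type*} [AddCommGroup M] [Module ℂ M] [Module A M]
    [IsScalarTower ℂ A M] (ε : Derivation ℂ A M) (y : A) :
    m • ε y = ∑ b ∈ I, δ b y • ε (x b) := by
  have h := congrArg ε.liftKaehlerDifferential (hI.smul_D y)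
  simpa using h

theorem IsFrame.smul_derivation {x : σ → A} {m : A} {I : Finset σ} {δ : σ → Derivation ℂ A A}
    (hI : IsFrame x m I δ) (ε : Derivation ℂ A A) : m • ε = ∑ b ∈ I, ε (x b) • δ b := by
  ext y
  have h := hI.smul_apply ε y
  have h2 : (∑ b ∈ I, ε (x b) • δ b) y = ∑ b ∈ I, ε (x b) • δ b y := by
    rw [← Derivation.coeFnAddMonoidHom_apply, map_sum, Finset.sum_apply]
    rfl
  rw [h2, Derivation.smul_apply, h]
  exact Finset.sum_congr rfl fun b _ => mul_comm _ _

variable [Fintype σ]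

/-- The equation that expresses that the one-form `ω - ∑ i, S i • d (x i)` vanishes on the vector
field `δ`. The unknown coefficients `S i` are the variables of the polynomial ring. -/
def critEquation (ω : Derivation ℂ A A →ₗ[A] A) (x : σ → A) (δ : Derivation ℂ A A) :
    MvPolynomial σ A :=
  C (ω δ) - ∑ i, C (δ (x i)) * X i

theorem critEquation_add (ω : Derivation ℂ A A →ₗ[A] A) (x : σ → A) (δ ε : Derivation ℂ A A) :
    critEquation ω x (δ + ε) = critEquation ω x δ + critEquation ω x ε := by
  simp only [critEquation, map_add, Derivation.add_apply, add_mul, Finset.sum_add_distrib]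
  ring

theorem critEquation_smul (ω : Derivation ℂ A A →ₗ[A] A) (x : σ → A) (a : A)
    (δ : Derivation ℂ A A) : critEquation ω x (a • δ) = C a * critEquation ω x δ := by
  simp only [critEquation, map_smul, Derivation.smul_apply, smul_eq_mul, map_mul, mul_sub,
    Finset.mul_sum, mul_assoc]

/-- The ideal of the incidence variety of all pairs of a point and a covector `S` such that the
point is a zero of `ω - ∑ i, S i • d (x i)`. -/
def incidenceIdeal (ω : Derivation ℂ A A →ₗ[A] A) (x : σ → A) : Ideal (MvPolynomial σ A) :=
  Ideal.span (Set.range (critEquation ω x))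

/-- The ideal of the zeros of the one-form `ω - ∑ i, S i • d (x i)`, for a fixed covector `S`. -/
def zeroIdeal (ω : Derivation ℂ A A →ₗ[A] A) (x : σ → A) (S : σ → ℂ) : Ideal A :=
  Ideal.span (Set.range fun δ : Derivation ℂ A A => ω δ - ∑ i, S i • δ (x i))

variable {ω : Derivation ℂ A A →ₗ[A] A} {x : σ → A}

theorem critEquation_mem (δ : Derivation ℂ A A) : critEquation ω x δ ∈ incidenceIdeal ω x :=
  Ideal.subset_span ⟨δ, rfl⟩

section Frame

variable {m : A} {I : Finset σ} {δ : σ → Derivation ℂ A A}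

variable (ω x I δ) in
open Classical in
/-- The right-hand side of the equation for `δ b` solved for `m * S b`. -/
def solvedEquation (b : σ) : MvPolynomial σ A :=
  C (ω (δ b)) - ∑ i ∈ Iᶜ, C (δ b (x i)) * X i

theorem IsFrame.critEquation_eq (hI : IsFrame x m I δ) {b : σ} (hb : b ∈ I) :
    critEquation ω x (δ b) = solvedEquation ω x I δ b - C m * X b := by
  classical
  rw [critEquation, solvedEquation, ← Finset.sum_add_sum_compl I,
    Finset.sum_eq_single_of_mem b hb, hI.apply_self b hb]
  · ring
  · intro c hc hcb
    rw [hI.apply_of_ne b hb c hc (Ne.symm hcb), C_0, zero_mul]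

variable [IsDomain A]

variable (ω x m I δ) in
open Classical in
/-- Solving the critical equations for the variables `S b`, `b ∈ I`, over the fraction field. -/
def solveHom : MvPolynomial σ A →+* MvPolynomial σ (FractionRing A) :=
  eval₂Hom (C.comp (algebraMap A (FractionRing A))) fun i =>
    if i ∈ I then
      C (algebraMap A (FractionRing A) m)⁻¹ *
        map (algebraMap A (FractionRing A)) (solvedEquation ω x I δ i)
    else X i

theorem solveHom_C (a : A) :
    solveHom ω x m I δ (C a) = C (algebraMap A (FractionRing A) a) := by
  simp [solveHom]

theorem solveHom_X_of_notMem {i : σ} (hi : i ∉ I) : solveHom ω x m I δ (X i) = X i := by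
  simp [solveHom, hi]

theorem solveHom_X_of_mem (hm : m ≠ 0) {i : σ} (hi : i ∈ I) :
    C (algebraMap A (FractionRing A) m) * solveHom ω x m I δ (X i) =
      map (algebraMap A (FractionRing A)) (solvedEquation ω x I δ i) := by
  have hm' : algebraMap A (FractionRing A) m ≠ 0 := by simpa using hm
  simp only [solveHom, coe_eval₂Hom, eval₂_X, if_pos hi]
  rw [← mul_assoc, ← C_mul, mul_inv_cancel₀ hm', C_1, one_mul]

omit [Algebra ℂ A] [Fintype σ] in
theorem C_algebraMap_ne_zero {a : A} (ha : a ≠ 0) :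
    (C (algebraMap A (FractionRing A) a) : MvPolynomial σ (FractionRing A)) ≠ 0 := by
  simpa using ha

theorem solveHom_solvedEquation (b : σ) :
    solveHom ω x m I δ (solvedEquation ω x I δ b) =
      map (algebraMap A (FractionRing A)) (solvedEquation ω x I δ b) := by
  simp only [solvedEquation, map_sub, map_sum, map_mul, solveHom_C, map_C, map_X]
  congr 1
  refine Finset.sum_congr rfl fun i hi => ?_
  rw [solveHom_X_of_notMem (by simpa using hi)]

/-- The solution over the fraction field satisfies all critical equations, because each derivation
is a combination of the `δ b` after multiplication by `m`. -/
theorem IsFrame.solveHom_eq_zero (hI : IsFrame x m I δ) (hm : m ≠ 0) {p : MvPolynomial σ A}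
    (hp : p ∈ incidenceIdeal ω x) : solveHom ω x m I δ p = 0 := by
  have hb : ∀ b ∈ I, solveHom ω x m I δ (critEquation ω x (δ b)) = 0 := by
    intro b hb
    rw [hI.critEquation_eq hb, map_sub, map_mul, solveHom_C, solveHom_X_of_mem hm hb,
      solveHom_solvedEquation, sub_self]
  have hle : incidenceIdeal ω x ≤ RingHom.ker (solveHom ω x m I δ) := by
    rw [incidenceIdeal, Ideal.span_le]
    rintro _ ⟨ε, rfl⟩
    rw [SetLike.mem_coe, RingHom.mem_ker]
    let E : Derivation ℂ A A →+ MvPolynomial σ A :=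
      AddMonoidHom.mk' (critEquation ω x) (critEquation_add ω x)
    have h1 : C m * critEquation ω x ε = ∑ b ∈ I, C (ε (x b)) * critEquation ω x (δ b) := by
      rw [← critEquation_smul, hI.smul_derivation]
      refine (map_sum E _ _).trans (Finset.sum_congr rfl fun b _ => ?_)
      exact critEquation_smul ω x _ _
    have h2 := congrArg (solveHom ω x m I δ) h1
    rw [map_mul, solveHom_C, map_sum, Finset.sum_eq_zero] at h2
    · exact (mul_eq_zero.1 h2).resolve_left (C_algebraMap_ne_zero hm)
    · intro b hbI
      rw [map_mul, hb b hbI, mul_zero]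
  exact hle hp

/-- Modulo the critical equations and up to a power of `m`, the variables `S b`, `b ∈ I`, can be
eliminated. -/
theorem IsFrame.exists_reduction (hI : IsFrame x m I δ) (hm : m ≠ 0) (p : MvPolynomial σ A) :
    ∃ (k : ℕ) (q : MvPolynomial σ A), C m ^ k * p - q ∈ incidenceIdeal ω x ∧
      map (algebraMap A (FractionRing A)) q =
        C (algebraMap A (FractionRing A) m) ^ k * solveHom ω x m I δ p := by
  induction p using MvPolynomial.induction_on with
  | C a => exact ⟨0, C a, by simp, by simp [solveHom_C]⟩
  | add p p' hp hp' =>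
    obtain ⟨k, q, h, e⟩ := hp
    obtain ⟨k', q', h', e'⟩ := hp'
    refine ⟨k + k', C m ^ k' * q + C m ^ k * q', ?_, ?_⟩
    · have := Ideal.add_mem _ (Ideal.mul_mem_left _ (C m ^ k') h)
        (Ideal.mul_mem_left _ (C m ^ k) h')
      convert this using 1
      ring
    · simp only [map_add, map_mul, map_pow, map_C, e, e', pow_add]
      ring
  | mul_X p i hp =>
    obtain ⟨k, q, h, e⟩ := hp
    by_cases hi : i ∈ I
    · refine ⟨k + 1, q * solvedEquation ω x I δ i, ?_, ?_⟩
      · have h1 : critEquation ω x (δ i) ∈ incidenceIdeal ω x := critEquation_mem _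
        rw [hI.critEquation_eq hi] at h1
        have := Ideal.sub_mem _ (Ideal.mul_mem_left _ (C m * X i) h)
          (Ideal.mul_mem_left _ q h1)
        convert this using 1
        ring
      · rw [map_mul, e, ← solveHom_X_of_mem hm hi, map_mul]
        ring
    · refine ⟨k, q * X i, ?_, ?_⟩
      · have := Ideal.mul_mem_left _ (X i) h
        convert this using 1
        ring
      · rw [map_mul, map_X, e, map_mul, solveHom_X_of_notMem hi, mul_assoc]

/-- The kernel of the solution homomorphism is the incidence ideal up to powers of `m`. -/
theorem IsFrame.exists_pow_mul_mem (hI : IsFrame x m I δ) (hm : m ≠ 0) {p : MvPolynomial σ A}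
    (hp : solveHom ω x m I δ p = 0) : ∃ k : ℕ, C m ^ k * p ∈ incidenceIdeal ω x := by
  obtain ⟨k, q, h, e⟩ := hI.exists_reduction (ω := ω) hm p
  rw [hp, mul_zero] at e
  have hq : q = 0 := map_injective _ (IsFractionRing.injective A (FractionRing A)) (by simpa using e)
  exact ⟨k, by simpa [hq] using h⟩

end Frame

/-- Near each closed point of `Spec A` some of the functions `x i` are local coordinates. -/
def HasFrames (x : σ → A) : Prop :=
  ∀ 𝔪 : Ideal A, 𝔪.IsMaximal → ∃ (m : A) (I : Finset σ) (δ : σ → Derivation ℂ A A),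
    m ∉ 𝔪 ∧ IsFrame x m I δ

variable [IsDomain A]

/-- The incidence ring has no `A`-torsion. This can be checked locally, where it is a polynomial
ring. -/
theorem HasFrames.mem_of_C_mul_mem (hx : HasFrames x) {a : A} (ha : a ≠ 0) {p : MvPolynomial σ A}
    (hp : C a * p ∈ incidenceIdeal ω x) : p ∈ incidenceIdeal ω x := by
  let T : Ideal A := ((incidenceIdeal ω x).colon {p}).comap C
  have hT : T = ⊤ := by
    by_contra hne
    obtain ⟨𝔪, h𝔪, hle⟩ := Ideal.exists_le_maximal T hne
    obtain ⟨m, I, δ, hm, hI⟩ := hx 𝔪 h𝔪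
    have hm0 : m ≠ 0 := fun h => hm (h ▸ 𝔪.zero_mem)
    have h0 : solveHom ω x m I δ p = 0 := by
      have := hI.solveHom_eq_zero hm0 hp
      rw [map_mul, solveHom_C] at this
      exact (mul_eq_zero.1 this).resolve_left (C_algebraMap_ne_zero ha)
    obtain ⟨k, hk⟩ := hI.exists_pow_mul_mem hm0 h0
    refine hm (h𝔪.isPrime.mem_of_pow_mem k (hle ?_))
    rw [Ideal.mem_comap, Submodule.mem_colon_singleton, map_pow]
    exact hk
  have h1 : (1 : A) ∈ T := hT ▸ Submodule.mem_top
  rw [Ideal.mem_comap, Submodule.mem_colon_singleton] at h1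
  simpa using h1

omit [Fintype σ] in
theorem HasFrames.exists_frame (hx : HasFrames x) :
    ∃ (m : A) (I : Finset σ) (δ : σ → Derivation ℂ A A), m ≠ 0 ∧ IsFrame x m I δ := by
  obtain ⟨𝔪, h𝔪⟩ := Ideal.exists_maximal A
  obtain ⟨m, I, δ, hm, hI⟩ := hx 𝔪 h𝔪
  exact ⟨m, I, δ, fun h => hm (h ▸ 𝔪.zero_mem), hI⟩

theorem HasFrames.mem_incidenceIdeal_iff (hx : HasFrames x) {m : A} {I : Finset σ}
    {δ : σ → Derivation ℂ A A} (hm : m ≠ 0) (hI : IsFrame x m I δ) {p : MvPolynomial σ A} :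
    p ∈ incidenceIdeal ω x ↔ solveHom ω x m I δ p = 0 := by
  refine ⟨hI.solveHom_eq_zero hm, fun h => ?_⟩
  obtain ⟨k, hk⟩ := hI.exists_pow_mul_mem hm h
  rw [← map_pow] at hk
  exact hx.mem_of_C_mul_mem (pow_ne_zero k hm) hk

/-- The incidence variety is irreducible: it is locally the product of `Spec A` with an affine
space. -/
theorem HasFrames.isPrime_incidenceIdeal (hx : HasFrames x) : (incidenceIdeal ω x).IsPrime := by
  obtain ⟨m, I, δ, hm, hI⟩ := hx.exists_frame
  have : incidenceIdeal ω x = RingHom.ker (solveHom ω x m I δ) := by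
    ext p
    rw [hx.mem_incidenceIdeal_iff hm hI, RingHom.mem_ker]
  rw [this]
  exact RingHom.ker_isPrime _

theorem HasFrames.mk_C_injective (hx : HasFrames x) :
    Function.Injective ((Ideal.Quotient.mk (incidenceIdeal ω x)).comp C) := by
  obtain ⟨m, I, δ, hm, hI⟩ := hx.exists_frame
  rw [injective_iff_map_eq_zero]
  intro a ha
  rw [RingHom.comp_apply, Ideal.Quotient.eq_zero_iff_mem, hx.mem_incidenceIdeal_iff hm hI,
    solveHom_C] at ha
  by_contra h
  exact C_algebraMap_ne_zero h ha

omit [Fintype σ] in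
/-- Local coordinates contain a transcendence basis: the fraction field of `A` is unramified over
the field generated by them, since the differentials of all functions are combinations of the
differentials of the coordinates. -/
theorem IsFrame.isAlgebraic_adjoin [Algebra.FiniteType ℂ A] {m : A} {I : Finset σ}
    {δ : σ → Derivation ℂ A A} (hm : m ≠ 0) (hI : IsFrame x m I δ) :
    Algebra.IsAlgebraic (Algebra.adjoin ℂ (x '' I)) A := by
  set A₀ := Algebra.adjoin ℂ (x '' I)
  let K₀ := FractionRing A₀
  set K := FractionRing A with hK
  let _ : Algebra K₀ K := FractionRing.liftAlgebra A₀ K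
  have : Algebra.EssFiniteType A K := .of_isLocalization K (nonZeroDivisors A)
  have : Algebra.EssFiniteType ℂ K := .comp ℂ A K
  have : Algebra.EssFiniteType A₀ K := .of_comp ℂ A₀ K
  have : Algebra.EssFiniteType K₀ K := .of_comp A₀ K₀ K
  have hunr : Algebra.FormallyUnramified A₀ K := by
    let d : Derivation ℂ A (Ω[K⁄A₀]) := ((D A₀ K).restrictScalars ℂ).compAlgebraMap A
    have hd : ∀ y : A, D A₀ K (algebraMap A K y) = 0 := by
      intro y
      have h := hI.smul_apply d y
      rw [Finset.sum_eq_zero] at h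
      · rw [← algebraMap_smul K, smul_eq_zero] at h
        exact h.resolve_left (by simpa using hm)
      · intro b hb
        have hxb : x b ∈ A₀ := Algebra.subset_adjoin ⟨b, hb, rfl⟩
        have : d (x b) = 0 := (D A₀ K).map_algebraMap ⟨x b, hxb⟩
        rw [this, smul_zero]
    have hD : ∀ z : K, D A₀ K z = 0 := by
      intro z
      obtain ⟨a, b, hb, rfl⟩ := IsFractionRing.div_surjective A z
      rw [Derivation.leibniz_div, hd, hd, smul_zero, smul_zero, sub_zero, smul_zero]
    constructor
    have h := span_range_derivation A₀ K
    have h0 : Set.range (D A₀ K) ⊆ {0} := by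
      rintro _ ⟨z, rfl⟩
      exact hD z
    rw [← Submodule.subsingleton_iff K, ← subsingleton_iff_bot_eq_top, ← h, eq_comm, eq_bot_iff]
    exact Submodule.span_le.2 h0
  have : Algebra.FormallyUnramified K₀ K := .of_restrictScalars A₀ K₀ K
  have : Algebra.IsSeparable K₀ K := Algebra.FormallyUnramified.isSeparable K₀ K
  have : Algebra.IsAlgebraic A₀ K :=
    (IsFractionRing.comap_isAlgebraic_iff (A := A₀) (K := K₀) (C := K)).2
      (Algebra.IsSeparable.isAlgebraic K₀ K)
  exact ⟨fun y => (isAlgebraic_algebraMap_iff (IsFractionRing.injective A K)).1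
    (Algebra.IsAlgebraic.isAlgebraic (algebraMap A K y))⟩

end CriticalEquations

/-! ### Zeros of generic one-forms -/

section GenericZeros

variable {σ : Type} {A : Type} [CommRing A] [Algebra ℂ A] [Fintype σ]
  {ω : Derivation ℂ A A →ₗ[A] A} {x : σ → A}

variable (ω x) in
/-- The coordinate ring of the incidence variety. -/
abbrev incidenceRing : Type := MvPolynomial σ A ⧸ incidenceIdeal ω x

variable (ω x) in
/-- The projection of the incidence variety to the space of covectors. -/
def covectorHom : MvPolynomial σ ℂ →ₐ[ℂ] incidenceRing ω x :=
  aeval fun i => Ideal.Quotient.mk _ (X i)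

theorem covectorHom_eq (p : MvPolynomial σ ℂ) :
    covectorHom ω x p = Ideal.Quotient.mk _ (map (algebraMap ℂ A) p) := by
  have h : (covectorHom ω x : MvPolynomial σ ℂ →+* incidenceRing ω x) =
      (Ideal.Quotient.mk (incidenceIdeal ω x)).comp (map (algebraMap ℂ A)) := by
    ext i
    · simp [covectorHom]; rfl
    · simp [covectorHom]
  exact RingHom.congr_fun h p

open Classical in
/-- The incidence variety has at most the dimension of the space of covectors: its coordinate ring
is algebraic over the local coordinates `x b`, `b ∈ I`, and the variables `S i`, `i ∉ I`. -/
theorem HasFrames.trdeg_le [IsDomain A] [Algebra.FiniteType ℂ A] (hx : HasFrames x) :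
    Algebra.trdeg ℂ (incidenceRing ω x) ≤ Cardinal.mk σ := by
  have := hx.isPrime_incidenceIdeal (ω := ω)
  obtain ⟨m, I, δ, hm, hI⟩ := hx.exists_frame
  set mk := Ideal.Quotient.mk (incidenceIdeal ω x) with hmk
  let t : σ → incidenceRing ω x := fun i => if i ∈ I then mk (C (x i)) else mk (X i)
  set A₁ := Algebra.adjoin ℂ (Set.range t) with hA₁
  set T := Subalgebra.algebraicClosure A₁ (incidenceRing ω x)
  have ht : ∀ i, t i ∈ T := fun i =>
    isAlgebraic_algebraMap (R := A₁) ⟨t i, Algebra.subset_adjoin ⟨i, rfl⟩⟩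
  have hC : ∀ a : A, mk (C a) ∈ T := by
    intro a
    have := hI.isAlgebraic_adjoin hm
    let g : A →ₐ[ℂ] incidenceRing ω x :=
      (Ideal.Quotient.mkₐ ℂ (incidenceIdeal ω x)).comp (IsScalarTower.toAlgHom ℂ A (MvPolynomial σ A))
    have hg : Function.Injective g := hx.mk_C_injective
    have hmem : ∀ y : Algebra.adjoin ℂ (x '' I), g y ∈ A₁ := by
      rintro ⟨y, hy⟩
      have h1 : g y ∈ (Algebra.adjoin ℂ (x '' I)).map g := ⟨y, hy, rfl⟩
      rw [AlgHom.map_adjoin] at h1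
      refine Algebra.adjoin_mono ?_ h1
      rintro _ ⟨_, ⟨b, hb, rfl⟩, rfl⟩
      refine ⟨b, ?_⟩
      have hb' : b ∈ I := hb
      simp only [t, if_pos hb']
      rfl
    let f : Algebra.adjoin ℂ (x '' I) →ₐ[ℂ] A₁ :=
      (g.comp (Subalgebra.val _)).codRestrict A₁ hmem
    have hf : Function.Injective f := by
      intro y z hyz
      exact Subtype.ext (hg (congrArg Subtype.val hyz))
    exact (Algebra.IsAlgebraic.isAlgebraic (R := Algebra.adjoin ℂ (x '' I)) a).ringHom_of_comp_eq
      f g hf rfl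
  have hX : ∀ i, mk (X i) ∈ T := by
    intro i
    by_cases hi : i ∈ I
    · have hm' : mk (C m) ≠ 0 := fun h => hm (hx.mk_C_injective (ω := ω) (by
        rw [map_zero]; exact h))
      refine IsAlgebraic.of_mul (mem_nonZeroDivisors_of_ne_zero hm') (hC m) ?_
      have h1 : mk (critEquation ω x (δ i)) = 0 :=
        Ideal.Quotient.eq_zero_iff_mem.2 (critEquation_mem _)
      rw [hI.critEquation_eq hi, map_sub, sub_eq_zero, map_mul] at h1
      change _ ∈ T
      rw [← h1, solvedEquation, map_sub, map_sum]
      refine T.sub_mem (hC _) (T.sum_mem fun j hj => ?_)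
      rw [map_mul]
      refine T.mul_mem (hC _) ?_
      have := ht j
      simpa only [t, if_neg (Finset.mem_compl.1 hj)] using this
    · have := ht i
      simpa only [t, if_neg hi] using this
  have halg : Algebra.IsAlgebraic A₁ (incidenceRing ω x) := by
    refine ⟨fun b => ?_⟩
    obtain ⟨p, rfl⟩ := Ideal.Quotient.mk_surjective b
    change mk p ∈ T
    induction p using MvPolynomial.induction_on with
    | C a => exact hC a
    | add p q hp hq => rw [map_add]; exact T.add_mem hp hq
    | mul_X p i hp => rw [map_mul]; exact T.mul_mem hp (hX i)
  exact (Algebra.IsAlgebraic.trdeg_le_cardinalMk ℂ (Set.range t)).trans Cardinal.mk_range_le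

/-- If the projection to the space of covectors is dominant, then it is generically finite, by
comparison of dimensions. -/
theorem HasFrames.isAlgebraic_covectorHom [IsDomain A] [Algebra.FiniteType ℂ A]
    (hx : HasFrames x) (hinj : Function.Injective (covectorHom ω x)) :
    letI := (covectorHom ω x).toRingHom.toAlgebra
    Algebra.IsAlgebraic (MvPolynomial σ ℂ) (incidenceRing ω x) := by
  have := hx.isPrime_incidenceIdeal (ω := ω)
  let _ := (covectorHom ω x).toRingHom.toAlgebra
  have hindep : AlgebraicIndependent ℂ
      fun i => (Ideal.Quotient.mk (incidenceIdeal ω x) (X i) : incidenceRing ω x) := hinj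
  have hbasis := hindep.isTranscendenceBasis_of_trdeg_le_of_finite hx.trdeg_le
  have halg := hbasis.isAlgebraic
  refine ⟨fun b => ?_⟩
  exact (halg.isAlgebraic b).of_ringHom_of_comp_eq (hindep.aevalEquiv.toRingEquiv : _ ≃+* _).toRingHom
    (RingHom.id (incidenceRing ω x)) hindep.aevalEquiv.surjective Function.injective_id
    (RingHom.ext fun p => hindep.algebraMap_aevalEquiv p)

omit [Algebra ℂ A] [Fintype σ] in
theorem sub_C_eval_mem_span (S : σ → A) (p : MvPolynomial σ A) :
    p - C (eval S p) ∈ Ideal.span (Set.range fun i => (X i - C (S i) : MvPolynomial σ A)) := by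
  induction p using MvPolynomial.induction_on with
  | C a => simp
  | add p q hp hq =>
    have := Ideal.add_mem _ hp hq
    rw [map_add, C_add]
    convert this using 1
    ring
  | mul_X p i hp =>
    have h1 : (X i - C (S i) : MvPolynomial σ A) ∈
      Ideal.span (Set.range fun i => (X i - C (S i) : MvPolynomial σ A)) :=
      Ideal.subset_span ⟨i, rfl⟩
    have := Ideal.add_mem _ (Ideal.mul_mem_left _ (X i) hp)
      (Ideal.mul_mem_left _ (C (eval S p)) h1)
    rw [map_mul, eval_X, C_mul]
    convert this using 1
    ring

theorem eval_critEquation (S : σ → ℂ) (δ : Derivation ℂ A A) :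
    eval (fun i => algebraMap ℂ A (S i)) (critEquation ω x δ) = ω δ - ∑ i, S i • δ (x i) := by
  simp [critEquation, Algebra.smul_def, mul_comm]

theorem eval_mem_zeroIdeal (S : σ → ℂ) {p : MvPolynomial σ A} (hp : p ∈ incidenceIdeal ω x) :
    eval (fun i => algebraMap ℂ A (S i)) p ∈ zeroIdeal ω x S := by
  have h : incidenceIdeal ω x ≤
      (zeroIdeal ω x S).comap (eval fun i => algebraMap ℂ A (S i)) := by
    rw [incidenceIdeal, Ideal.span_le]
    rintro _ ⟨δ, rfl⟩
    rw [SetLike.mem_coe, Ideal.mem_comap, eval_critEquation]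
    exact Ideal.subset_span ⟨δ, rfl⟩
  exact h hp

variable (ω x) in
/-- The restriction from the incidence variety to the fibre over the covector `S`. -/
def fibreHom (S : σ → ℂ) : incidenceRing ω x →+* A ⧸ zeroIdeal ω x S :=
  Ideal.Quotient.lift _ ((Ideal.Quotient.mk (zeroIdeal ω x S)).comp
    (eval fun i => algebraMap ℂ A (S i)))
    fun _ hp => Ideal.Quotient.eq_zero_iff_mem.2 (eval_mem_zeroIdeal S hp)

theorem fibreHom_mk (S : σ → ℂ) (p : MvPolynomial σ A) :
    fibreHom ω x S (Ideal.Quotient.mk _ p) =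
      Ideal.Quotient.mk _ (eval (fun i => algebraMap ℂ A (S i)) p) :=
  rfl

theorem fibreHom_surjective (S : σ → ℂ) : Function.Surjective (fibreHom ω x S) := by
  intro y
  obtain ⟨a, rfl⟩ := Ideal.Quotient.mk_surjective y
  exact ⟨Ideal.Quotient.mk _ (C a), by rw [fibreHom_mk, eval_C]⟩

theorem fibreHom_covectorHom (S : σ → ℂ) (p : MvPolynomial σ ℂ) :
    fibreHom ω x S (covectorHom ω x p) = algebraMap ℂ _ (eval S p) := by
  rw [covectorHom_eq, fibreHom_mk, eval_map]
  have : eval₂ (algebraMap ℂ A) (fun i => algebraMap ℂ A (S i)) p = algebraMap ℂ A (eval S p) := by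
    rw [eval, coe_eval₂Hom, eval₂_comp_left (algebraMap ℂ A)]
    rfl
  rw [this]
  rfl

/-- The scheme of zeros for the covector `S` is the full scheme-theoretic fibre. -/
theorem mem_map_of_fibreHom_eq_zero (S : σ → ℂ) {b : incidenceRing ω x}
    (hb : fibreHom ω x S b = 0) :
    b ∈ (RingHom.ker (eval S)).map (covectorHom ω x : MvPolynomial σ ℂ →+* _) := by
  obtain ⟨p, rfl⟩ := Ideal.Quotient.mk_surjective b
  rw [fibreHom_mk, Ideal.Quotient.eq_zero_iff_mem] at hb
  set S' : σ → A := fun i => algebraMap ℂ A (S i)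
  -- an element of the ideal of the fibre lifts to an element of the incidence ideal
  have hlift : zeroIdeal ω x S ≤ (incidenceIdeal ω x).map (eval S') := by
    rw [zeroIdeal, Ideal.span_le]
    rintro _ ⟨δ, rfl⟩
    change ω δ - ∑ i, S i • δ (x i) ∈ _
    rw [← eval_critEquation]
    exact Ideal.mem_map_of_mem _ (critEquation_mem δ)
  have hsurj : Function.Surjective (eval S' : MvPolynomial σ A →+* A) := fun a => ⟨C a, eval_C a⟩
  obtain ⟨q, hq, hqp⟩ := (Ideal.mem_map_iff_of_surjective _ hsurj).1 (hlift hb)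
  have h1 := sub_C_eval_mem_span S' (p - q)
  rw [map_sub, hqp, sub_self, C_0, sub_zero] at h1
  have h2 : Ideal.Quotient.mk (incidenceIdeal ω x) p = Ideal.Quotient.mk _ (p - q) := by
    rw [map_sub, Ideal.Quotient.eq_zero_iff_mem.2 hq, sub_zero]
  rw [h2]
  have hle : Ideal.span (Set.range fun i => (X i - C (S' i) : MvPolynomial σ A)) ≤
      ((RingHom.ker (eval S)).map (covectorHom ω x : MvPolynomial σ ℂ →+* _)).comap
        (Ideal.Quotient.mk (incidenceIdeal ω x)) := by
    rw [Ideal.span_le]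
    rintro _ ⟨i, rfl⟩
    have h3 : (X i - C (S i) : MvPolynomial σ ℂ) ∈ RingHom.ker (eval S) := by
      simp [RingHom.mem_ker]
    have h4 := Ideal.mem_map_of_mem (covectorHom ω x : MvPolynomial σ ℂ →+* incidenceRing ω x) h3
    rw [SetLike.mem_coe, Ideal.mem_comap]
    convert h4 using 1
    rw [RingHom.coe_coe, covectorHom_eq, map_sub (map (algebraMap ℂ A)), map_X, map_C]
  exact hle h1

/-- For generic `S` the scheme of zeros of `ω - ∑ i, S i • d (x i)` is reduced, and its number of
points does not depend on `S`. -/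
theorem HasFrames.exists_card_zeros [IsDomain A] [Algebra.FiniteType ℂ A] (hx : HasFrames x)
    (ω : Derivation ℂ A A →ₗ[A] A) :
    ∃ d : ℕ, ForGeneric fun S : σ → ℂ => IsReduced (A ⧸ zeroIdeal ω x S) ∧
      ENat.card ((A ⧸ zeroIdeal ω x S) →ₐ[ℂ] ℂ) = d := by
  by_cases hinj : Function.Injective (covectorHom ω x)
  · have := hx.isPrime_incidenceIdeal (ω := ω)
    have hfin : (covectorHom ω x).FiniteType := by
      have h : ((covectorHom ω x).comp (Algebra.ofId ℂ (MvPolynomial σ ℂ))).FiniteType := by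
        have h1 : Algebra.FiniteType ℂ (MvPolynomial σ A) := .trans (S := A) ‹_› inferInstance
        have h2 : Algebra.FiniteType ℂ (incidenceRing ω x) := inferInstance
        have h3 : (covectorHom ω x).comp (Algebra.ofId ℂ (MvPolynomial σ ℂ)) =
          Algebra.ofId ℂ (incidenceRing ω x) := Subsingleton.elim _ _
        rw [h3]
        exact RingHom.finiteType_algebraMap.2 h2
      exact h.of_comp_finiteType
    have halg := hx.isAlgebraic_covectorHom hinj
    let _ := (covectorHom ω x).toRingHom.toAlgebra
    have : Algebra.FiniteType (MvPolynomial σ ℂ) (incidenceRing ω x) := hfin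
    have : FaithfulSMul (MvPolynomial σ ℂ) (incidenceRing ω x) :=
      (faithfulSMul_iff_algebraMap_injective _ _).2 hinj
    obtain ⟨d, h, hh, hd⟩ := exists_card_fibre_of_isAlgebraic (R := MvPolynomial σ ℂ)
      (B := incidenceRing ω x)
    exact ⟨d, h, hh, fun S hS => hd (eval S) (fun a => ⟨C a, eval_C a⟩) hS _ (fibreHom ω x S)
      (fibreHom_surjective S) (fibreHom_covectorHom S) fun b => mem_map_of_fibreHom_eq_zero S⟩
  · -- the image of the incidence variety is not dense, so the generic fibre is empty
    rw [injective_iff_map_eq_zero] at hinj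
    push Not at hinj
    obtain ⟨h, hh, hh0⟩ := hinj
    refine ⟨0, h, hh0, fun S hS => ?_⟩
    have h1 := fibreHom_covectorHom (ω := ω) (x := x) S h
    rw [hh, map_zero] at h1
    have h2 : (1 : A ⧸ zeroIdeal ω x S) = 0 := by
      have := (IsUnit.mk0 _ hS).map (algebraMap ℂ (A ⧸ zeroIdeal ω x S))
      rw [← h1, isUnit_zero_iff] at this
      exact this.symm
    have : Subsingleton (A ⧸ zeroIdeal ω x S) := subsingleton_of_zero_eq_one h2.symm
    refine ⟨inferInstance, ?_⟩
    have : IsEmpty ((A ⧸ zeroIdeal ω x S) →ₐ[ℂ] ℂ) := ⟨fun f => by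
      have := congrArg f h2
      rw [map_one, map_zero] at this
      exact one_ne_zero this⟩
    simp

end GenericZeros

/-! ### Vector fields tangent to a smooth cone -/

section PolynomialDerivatives

variable {σ : Type} [Fintype σ]

/-- The chain rule for polynomials. -/
theorem derivation_aeval_eq_sum {A M : Type*} [CommRing A] [Algebra ℂ A] [AddCommGroup M]
    [Module ℂ M] [Module A M] (T : MvPolynomial σ ℂ →ₐ[ℂ] A)
    (d : Derivation ℂ A M) (g : MvPolynomial σ ℂ) :
    d (T g) = ∑ i, T (pderiv i g) • d (T (X i)) := by
  classical
  induction g using MvPolynomial.induction_on with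
  | C a =>
    have : T (C a) = algebraMap ℂ A a := T.commutes a
    simp [this]
  | add p q hp hq => simp [hp, hq, add_smul, Finset.sum_add_distrib]
  | mul_X p i hp =>
    have h1 : ∀ j, pderiv j (p * X i) = p * (if j = i then 1 else 0) + X i * pderiv j p := by
      intro j
      rw [Derivation.leibniz, pderiv_X, smul_eq_mul, smul_eq_mul, Pi.single_apply]
      simp only [eq_comm]
    simp only [h1, map_mul, Derivation.leibniz, hp, map_add, add_smul, Finset.sum_add_distrib,
      mul_smul, Finset.smul_sum]
    congr 1
    rw [Finset.sum_eq_single i]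
    · simp
    · intro j _ hj; simp [hj]
    · simp

theorem differential_apply (g : MvPolynomial σ ℂ) (x v : σ → ℂ) :
    ProjVariety.differential g x v = ∑ i, eval x (pderiv i g) * v i := by
  simp [ProjVariety.differential]

/-- The linear form with coefficients `S`. -/
def linearForm (S : σ → ℂ) : MvPolynomial σ ℂ := ∑ i, C (S i) * X i

end PolynomialDerivatives

namespace ProjVariety

variable {σ : Type} [Fintype σ] (X : ProjVariety σ)

theorem mem_coneTangentSpace {x v : σ → ℂ} :
    v ∈ X.coneTangentSpace x ↔ ∀ g ∈ X.ideal, differential g x v = 0 := by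
  simp [coneTangentSpace, Submodule.mem_iInf]

/-- The cone is the zero locus of the homogeneous ideal. -/
theorem mem_cone_of_forall_eval_eq_zero {x : σ → ℂ} (hx : ∀ g ∈ X.ideal, eval x g = 0) :
    x ∈ X.cone := by
  intro h0
  obtain ⟨T, hT, hX⟩ := X.isClosed
  rw [hX]
  intro g hg
  obtain ⟨d, hd⟩ := hT g hg
  have hgI : g ∈ X.ideal := by
    rw [X.mem_ideal_iff_of_isHomogeneous hd, hX]
    rintro p hp _ rfl
    exact hp _ hg
  obtain ⟨a, ha⟩ := Projectivization.exists_smul_eq_mk_rep ℂ x h0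
  rw [← ha, Units.smul_def, eval_smul_of_isHomogeneous hd, hx g hgI, mul_zero]

/-- The space of the differentials at `x` of all polynomials in the ideal of `X`. -/
def conormalSpace (x : σ → ℂ) : Submodule ℂ (Module.Dual ℂ (σ → ℂ)) where
  carrier := {ℓ | ∃ g ∈ X.ideal, differential g x = ℓ}
  zero_mem' := ⟨0, X.ideal.zero_mem, by simp [differential]⟩
  add_mem' := by
    rintro _ _ ⟨g, hg, rfl⟩ ⟨g', hg', rfl⟩
    exact ⟨g + g', X.ideal.add_mem hg hg', by
      simp [differential, add_smul, Finset.sum_add_distrib]⟩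
  smul_mem' := by
    rintro a _ ⟨g, hg, rfl⟩
    exact ⟨C a * g, X.ideal.mul_mem_left _ hg, by
      simp [differential, mul_smul, Finset.smul_sum]⟩

theorem coneTangentSpace_eq (x : σ → ℂ) :
    X.coneTangentSpace x = (X.conormalSpace x).dualCoannihilator := by
  ext v
  rw [mem_coneTangentSpace, Submodule.mem_dualCoannihilator]
  constructor
  · rintro h _ ⟨g, hg, rfl⟩
    exact h g hg
  · exact fun h g hg => h _ ⟨g, hg, rfl⟩

theorem finrank_conormalSpace (x : σ → ℂ) :
    Module.finrank ℂ (X.conormalSpace x) + Module.finrank ℂ (X.coneTangentSpace x) =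
      Fintype.card σ := by
  rw [coneTangentSpace_eq, Subspace.finrank_add_finrank_dualCoannihilator_eq,
    Module.finrank_fintype_fun_eq_card]

variable [DecidableEq σ]

/-- Near `x`, the coordinates in a suitable set `I` are local coordinates on the cone, and the
other coordinates are cut out transversally by equations `g j`. -/
theorem exists_transversal_equations (x : σ → ℂ) :
    ∃ (I : Finset σ) (g : {i // i ∉ I} → MvPolynomial σ ℂ), (∀ j, g j ∈ X.ideal) ∧
      Fintype.card {i // i ∉ I} = Module.finrank ℂ (X.conormalSpace x) ∧
      ∀ i j : {i // i ∉ I}, eval x (pderiv i.1 (g j)) = if i = j then 1 else 0 := by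
  let T := X.coneTangentSpace x
  -- the coordinate forms span the dual of the tangent space; choose a basis among them
  let π : σ → Module.Dual ℂ T := fun i => (LinearMap.proj i).comp T.subtype
  have hspan : Submodule.span ℂ (Set.range π) = ⊤ := by
    rw [eq_top_iff]
    intro ℓ _
    obtain ⟨ℓ', rfl⟩ := LinearMap.exists_extend ℓ
    have : ℓ'.comp T.subtype = ∑ i, ℓ' (Pi.single i 1) • π i := by
      ext v
      have h1 : (v : σ → ℂ) = ∑ i, (v : σ → ℂ) i • Pi.single i (1 : ℂ) := by
        ext j
        simp [Finset.sum_apply, Pi.single_apply]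
      rw [LinearMap.comp_apply, Submodule.subtype_apply]
      conv_lhs => rw [h1]
      simp [π, mul_comm]
    rw [this]
    exact Submodule.sum_mem _ fun i _ => Submodule.smul_mem _ _ (Submodule.subset_span ⟨i, rfl⟩)
  obtain ⟨κ, a, ha, hκspan, hind⟩ := exists_linearIndependent' ℂ π
  have : Fintype κ := Fintype.ofInjective a ha
  let I : Finset σ := Finset.univ.map ⟨a, ha⟩
  have hcardI : I.card = Module.finrank ℂ (X.coneTangentSpace x) := by
    change _ = Module.finrank ℂ T
    rw [Finset.card_map, Finset.card_univ, ← Subspace.dual_finrank_eq,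
      ← finrank_top ℂ (Module.Dual ℂ T), ← hspan, ← hκspan, finrank_span_eq_card hind]
  have hcard : Fintype.card {i // i ∉ I} = Module.finrank ℂ (X.conormalSpace x) := by
    rw [Fintype.card_subtype_compl, Fintype.card_coe, hcardI]
    have := X.finrank_conormalSpace x
    omega
  let ρ : X.conormalSpace x →ₗ[ℂ] ({i // i ∉ I} → ℂ) :=
    LinearMap.pi fun i => (LinearMap.applyₗ (Pi.single i.1 (1 : ℂ))).comp
      (X.conormalSpace x).subtype
  have hinj : Function.Injective ρ := by
    rw [← LinearMap.ker_eq_bot, eq_bot_iff]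
    rintro ⟨ℓ, hℓ⟩ h0
    have h1 : ∀ i ∉ I, ℓ (Pi.single i 1) = 0 := fun i hi => congrFun h0 ⟨i, hi⟩
    have h2 : ∑ k, ℓ (Pi.single (a k) 1) • (π ∘ a) k = 0 := by
      ext v
      have h3 : (v : σ → ℂ) = ∑ i, (v : σ → ℂ) i • Pi.single i (1 : ℂ) := by
        ext j
        simp [Finset.sum_apply, Pi.single_apply]
      have h4 : ℓ v = 0 := by
        have hv : (v : σ → ℂ) ∈ X.coneTangentSpace x := v.2
        rw [X.coneTangentSpace_eq x, Submodule.mem_dualCoannihilator] at hv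
        exact hv ℓ hℓ
      rw [h3, map_sum, ← Finset.sum_subset (Finset.subset_univ I)] at h4
      · rw [Finset.sum_map] at h4
        simpa [π, mul_comm] using h4
      · intro i _ hi
        rw [map_smul, h1 i hi, smul_zero]
    have h5 := Fintype.linearIndependent_iff.1 hind _ h2
    have h6 : ℓ = 0 := by
      refine LinearMap.pi_ext' fun i => LinearMap.ext_ring ?_
      by_cases hi : i ∈ I
      · obtain ⟨k, _, rfl⟩ := Finset.mem_map.1 hi
        simpa using h5 k
      · simpa using h1 i hi
    simpa using h6
  have hsurj : Function.Surjective ρ := by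
    rw [← LinearMap.injective_iff_surjective_of_finrank_eq_finrank]
    · exact hinj
    · rw [Module.finrank_fintype_fun_eq_card, hcard]
  have hex : ∀ j : {i // i ∉ I}, ∃ g ∈ X.ideal, ∀ i : {i // i ∉ I},
      eval x (pderiv i.1 g) = if i = j then 1 else 0 := by
    intro j
    obtain ⟨⟨_, g, hg, rfl⟩, h⟩ := hsurj (Pi.single j 1)
    refine ⟨g, hg, fun i => ?_⟩
    have h1 := congrFun h i
    rw [Pi.single_apply] at h1
    rw [← h1]
    change _ = differential g x (Pi.single i.1 1)
    rw [differential_apply]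
    simp [Pi.single_apply]
  choose g hg hgx using hex
  exact ⟨I, g, hg, hcard, fun i j => hgx j i⟩

/-- The vector fields of Cramer's rule, for the Jacobian matrix `M` of some equations `g j` with
respect to the coordinates not in `I`. -/
def cramerField (I : Finset σ) (g : {i // i ∉ I} → MvPolynomial σ ℂ) (b c : σ) :
    MvPolynomial σ ℂ :=
  letI M : Matrix {i // i ∉ I} {i // i ∉ I} (MvPolynomial σ ℂ) :=
    Matrix.of fun j i => pderiv i.1 (g j)
  if h : c ∉ I then -∑ j, M.adjugate ⟨c, h⟩ j * pderiv b (g j) else if b = c then M.det else 0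

omit X in
theorem sum_eq_sum_add_sum_notMem {M : Type*} [AddCommMonoid M] (I : Finset σ) (f : σ → M) :
    ∑ i, f i = ∑ i ∈ I, f i + ∑ i : {i // i ∉ I}, f i := by
  rw [← Finset.sum_add_sum_compl I]
  congr 1
  exact Finset.sum_subtype _ (fun i => Finset.mem_compl) f

omit X in
theorem cramerField_of_mem {I : Finset σ} (g : {i // i ∉ I} → MvPolynomial σ ℂ) (b : σ) {c : σ}
    (hc : c ∈ I) : cramerField I g b c = if b = c then
      (Matrix.of fun j i : {i // i ∉ I} => pderiv i.1 (g j)).det else 0 := by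
  rw [cramerField, dif_neg (not_not.2 hc)]

omit X in
theorem cramerField_of_notMem {I : Finset σ} (g : {i // i ∉ I} → MvPolynomial σ ℂ) (b : σ)
    (c : {i // i ∉ I}) : cramerField I g b c =
      -∑ j, (Matrix.of fun j i : {i // i ∉ I} => pderiv i.1 (g j)).adjugate c j *
        pderiv b (g j) := by
  rw [cramerField, dif_pos c.2]

omit X in
/-- The vector fields of Cramer's rule annihilate the equations. -/
theorem sum_cramerField_mul_pderiv {I : Finset σ} (g : {i // i ∉ I} → MvPolynomial σ ℂ) {b : σ}
    (hb : b ∈ I) (j : {i // i ∉ I}) : ∑ c, cramerField I g b c * pderiv c (g j) = 0 := by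
  set M : Matrix {i // i ∉ I} {i // i ∉ I} (MvPolynomial σ ℂ) :=
    Matrix.of fun j i => pderiv i.1 (g j) with hM
  have h1 : ∑ c ∈ I, cramerField I g b c * pderiv c (g j) = M.det * pderiv b (g j) := by
    rw [Finset.sum_eq_single_of_mem b hb, cramerField_of_mem g b hb, if_pos rfl]
    intro c hc hcb
    rw [cramerField_of_mem g b hc, if_neg (Ne.symm hcb), zero_mul]
  have h2 : ∑ c : {i // i ∉ I}, cramerField I g b c * pderiv c.1 (g j) =
      -∑ k, (M * M.adjugate) j k * pderiv b (g k) := by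
    have hMjc : ∀ c : {i // i ∉ I}, pderiv c.1 (g j) = M j c := fun _ => rfl
    simp only [cramerField_of_notMem, ← hM, hMjc, Matrix.mul_apply, neg_mul, Finset.sum_mul,
      Finset.sum_neg_distrib]
    rw [Finset.sum_comm]
    refine congrArg _ (Finset.sum_congr rfl fun k _ => Finset.sum_congr rfl fun c _ => ?_)
    rw [mul_right_comm, mul_comm (M.adjugate c k)]
  rw [sum_eq_sum_add_sum_notMem I, h1, h2, Matrix.mul_adjugate]
  simp [Matrix.one_apply]

omit X in
/-- Cramer's rule: a solution `w` of the linearized equations is determined by its components in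
`I`. -/
theorem det_smul_eq_sum_cramerField {I : Finset σ} (g : {i // i ∉ I} → MvPolynomial σ ℂ)
    {A M : Type*} [CommRing A] [AddCommGroup M] [Module A M] (f : MvPolynomial σ ℂ →+* A)
    (w : σ → M) (hw : ∀ j, ∑ c, f (pderiv c (g j)) • w c = 0) (i : σ) :
    f (Matrix.of fun j i : {i // i ∉ I} => pderiv i.1 (g j)).det • w i =
      ∑ b ∈ I, f (cramerField I g b i) • w b := by
  set M' : Matrix {i // i ∉ I} {i // i ∉ I} (MvPolynomial σ ℂ) :=
    Matrix.of fun j i => pderiv i.1 (g j) with hM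
  by_cases hi : i ∈ I
  · rw [Finset.sum_eq_single_of_mem i hi, cramerField_of_mem g i hi, if_pos rfl]
    intro b hb hbi
    rw [cramerField_of_mem g b hi, if_neg hbi, map_zero, zero_smul]
  · have h1 : ∑ j, f (M'.adjugate ⟨i, hi⟩ j) • ∑ c, f (pderiv c (g j)) • w c = 0 :=
      Finset.sum_eq_zero fun j _ => by rw [hw, smul_zero]
    simp only [sum_eq_sum_add_sum_notMem I, smul_add, Finset.sum_add_distrib, Finset.smul_sum,
      smul_smul, ← map_mul] at h1
    have h2 : ∑ j, ∑ c : {i // i ∉ I}, f (M'.adjugate ⟨i, hi⟩ j * pderiv c.1 (g j)) • w c =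
        f M'.det • w i := by
      have h3 : ∀ c : {i // i ∉ I}, ∑ j, f (M'.adjugate ⟨i, hi⟩ j * pderiv c.1 (g j)) • w c =
          f ((M'.adjugate * M') ⟨i, hi⟩ c) • w c := by
        intro c
        rw [Matrix.mul_apply, map_sum, Finset.sum_smul]
        rfl
      rw [Finset.sum_comm, Finset.sum_congr rfl fun c _ => h3 c, Matrix.adjugate_mul,
        Finset.sum_eq_single ⟨i, hi⟩]
      · simp
      · intro c _ hc
        simp [Ne.symm hc]
      · simp
    have h4 : ∑ j, ∑ b ∈ I, f (M'.adjugate ⟨i, hi⟩ j * pderiv b (g j)) • w b =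
        -∑ b ∈ I, f (cramerField I g b i) • w b := by
      rw [Finset.sum_comm, ← Finset.sum_neg_distrib]
      refine Finset.sum_congr rfl fun b _ => ?_
      rw [cramerField_of_notMem g b ⟨i, hi⟩, map_neg, neg_smul, neg_neg, map_sum, Finset.sum_smul]
    rw [h2, h4] at h1
    exact (neg_add_eq_zero.1 h1).symm

/-- The cone over `X` is smooth where `F ≠ 0`, in the sense that its tangent spaces there have the
same dimension. -/
def SmoothCone (F : MvPolynomial σ ℂ) : Prop :=
  ∀ x ∈ X.cone, ∀ y ∈ X.cone, eval x F ≠ 0 → eval y F ≠ 0 →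
    Module.finrank ℂ (X.coneTangentSpace x) = Module.finrank ℂ (X.coneTangentSpace y)

/-- On a smooth cone the vector fields of Cramer's rule are tangent to the cone: where the
determinant does not vanish, the differentials of the equations span the conormal space. -/
theorem SmoothCone.exists_tangent_fields {F : MvPolynomial σ ℂ} {X : ProjVariety σ}
    (hF : F ∉ X.ideal) (hX : X.SmoothCone F) {x : σ → ℂ} (hx : x ∈ X.cone) (hxF : eval x F ≠ 0) :
    ∃ (m : MvPolynomial σ ℂ) (I : Finset σ) (u : σ → σ → MvPolynomial σ ℂ),
      eval x m ≠ 0 ∧ (∀ b, ∀ c ∈ I, u b c = if b = c then m else 0) ∧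
      (∀ b ∈ I, ∀ g ∈ X.ideal, ∑ c, u b c * pderiv c g ∈ X.ideal) ∧
      ∀ (A M : Type) [CommRing A] [AddCommGroup M] [Module A M] (f : MvPolynomial σ ℂ →+* A)
        (w : σ → M), (∀ g ∈ X.ideal, ∑ c, f (pderiv c g) • w c = 0) →
        ∀ i, f m • w i = ∑ b ∈ I, f (u b i) • w b := by
  obtain ⟨I, g, hg, hcard, hgx⟩ := X.exists_transversal_equations x
  set M : Matrix {i // i ∉ I} {i // i ∉ I} (MvPolynomial σ ℂ) :=
    Matrix.of fun j i => pderiv i.1 (g j) with hM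
  have hmx : eval x M.det = 1 := by
    have : (eval x).mapMatrix M = 1 := by
      ext j i
      simp [hM, hgx, Matrix.one_apply, eq_comm]
    rw [RingHom.map_det, this, Matrix.det_one]
  have hmI : M.det ∉ X.ideal := fun h => by
    rw [mem_ideal_iff] at h
    exact one_ne_zero (hmx.symm.trans (h x hx))
  refine ⟨M.det, I, cramerField I g, by rw [hmx]; exact one_ne_zero,
    fun b c hc => cramerField_of_mem g b hc, ?_, fun A N _ _ _ f w hw i =>
      det_smul_eq_sum_cramerField g f w (fun j => hw _ (hg j)) i⟩
  intro b hb h hh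
  refine (X.ideal_isPrime.mem_or_mem (?_ : M.det * F * _ ∈ X.ideal)).resolve_left
    fun h' => (X.ideal_isPrime.mem_or_mem h').elim hmI hF
  rw [mem_ideal_iff]
  intro y hy
  rw [map_mul, map_mul]
  by_cases hy0 : eval y M.det = 0
  · rw [hy0]; ring
  by_cases hyF : eval y F = 0
  · rw [hyF]; ring
  -- the differentials of the equations are a basis of the conormal space at `y`
  let ℓ : {i // i ∉ I} → X.conormalSpace y := fun j => ⟨differential (g j) y, g j, hg j, rfl⟩
  have hind : LinearIndependent ℂ ℓ := by
    rw [Fintype.linearIndependent_iff]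
    intro t ht
    have h1 : Matrix.vecMul t (M.map (eval y)) = 0 := by
      ext i
      have h2 := LinearMap.congr_fun (congrArg Subtype.val ht) (Pi.single i.1 1)
      simpa [ℓ, differential_apply, Pi.single_apply, Matrix.vecMul, dotProduct, hM] using h2
    have h3 : (M.map (eval y)).det ≠ 0 := by
      rw [← RingHom.mapMatrix_apply, ← RingHom.map_det]; exact hy0
    exact congrFun (Matrix.eq_zero_of_vecMul_eq_zero h3 h1)
  have hrank : Fintype.card {i // i ∉ I} = Module.finrank ℂ (X.conormalSpace y) := by
    rw [hcard]
    have h1 := X.finrank_conormalSpace x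
    have h2 := X.finrank_conormalSpace y
    have h3 := hX x hx y hy hxF hyF
    omega
  have hspan := hind.span_eq_top_of_card_eq_finrank' hrank
  let v : σ → ℂ := fun c => eval y (cramerField I g b c)
  have hv : ∀ φ : X.conormalSpace y, φ.1 v = 0 := by
    intro φ
    have hle : Submodule.span ℂ (Set.range ℓ) ≤
        LinearMap.ker ((LinearMap.applyₗ v).comp (X.conormalSpace y).subtype) := by
      rw [Submodule.span_le]
      rintro _ ⟨j, rfl⟩
      change differential (g j) y v = 0
      have h1 := congrArg (eval y) (sum_cramerField_mul_pderiv g hb j)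
      rw [differential_apply]
      simpa [v, mul_comm] using h1
    exact hle (hspan ▸ Submodule.mem_top)
  have h1 := hv ⟨differential h y, h, hh, rfl⟩
  change differential h y v = 0 at h1
  rw [differential_apply] at h1
  have h2 : eval y (∑ c, cramerField I g b c * pderiv c h) = 0 := by
    rw [← h1]
    simp [v, mul_comm]
  rw [h2, mul_zero]

end ProjVariety

/-! ### The coordinate ring of the open part of the cone -/

namespace ProjVariety

variable {σ : Type} [Fintype σ] (X : ProjVariety σ) (F : MvPolynomial σ ℂ)

/-- The restriction of polynomial functions to the open part of the cone. -/
def openConeHom : MvPolynomial σ ℂ →ₐ[ℂ] X.openConeRing F :=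
  (IsScalarTower.toAlgHom ℂ X.coordRing (X.openConeRing F)).comp (Ideal.Quotient.mkₐ ℂ X.ideal)

variable {X F}

theorem openConeHom_eq (g : MvPolynomial σ ℂ) : X.openConeHom F g = X.toOpenConeRing F g := rfl

theorem openConeHom_eq_zero {g : MvPolynomial σ ℂ} (hg : g ∈ X.ideal) : X.openConeHom F g = 0 := by
  rw [openConeHom_eq, toOpenConeRing, Ideal.Quotient.eq_zero_iff_mem.2 hg, map_zero]

theorem isUnit_openConeHom : IsUnit (X.openConeHom F F) :=
  IsLocalization.Away.algebraMap_isUnit (S := X.openConeRing F) (Ideal.Quotient.mk X.ideal F)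

theorem exists_mul_pow_eq_openConeHom (a : X.openConeRing F) :
    ∃ (k : ℕ) (g : MvPolynomial σ ℂ), a * X.openConeHom F F ^ k = X.openConeHom F g := by
  obtain ⟨k, y, hy⟩ := IsLocalization.Away.surj (Ideal.Quotient.mk X.ideal F) a
  obtain ⟨g, rfl⟩ := Ideal.Quotient.mk_surjective y
  exact ⟨k, g, hy⟩

instance finiteType_openConeRing : Algebra.FiniteType ℂ (X.openConeRing F) :=
  .trans (S := X.coordRing) inferInstance
    (IsLocalization.finiteType_of_monoid_fg (.powers (Ideal.Quotient.mk X.ideal F)) _)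

theorem isDomain_openConeRing (hF : F ∉ X.ideal) : IsDomain (X.openConeRing F) :=
  IsLocalization.isDomain_localization (powers_le_nonZeroDivisors_of_noZeroDivisors
    fun h => hF (Ideal.Quotient.eq_zero_iff_mem.1 h))

theorem openCone_algHom_ext {E : Type*} [Semiring E] [Algebra ℂ E]
    {φ ψ : X.openConeRing F →ₐ[ℂ] E}
    (h : ∀ i, φ (X.openConeHom F (.X i)) = ψ (X.openConeHom F (.X i))) : φ = ψ := by
  have h1 : ∀ g, φ (X.openConeHom F g) = ψ (X.openConeHom F g) := fun g =>
    AlgHom.congr_fun (MvPolynomial.algHom_ext (f := φ.comp (X.openConeHom F))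
      (g := ψ.comp (X.openConeHom F)) h) g
  refine AlgHom.ext fun a => ?_
  obtain ⟨k, g, hg⟩ := exists_mul_pow_eq_openConeHom a
  have hu : IsUnit (φ (X.openConeHom F F ^ k)) := (isUnit_openConeHom.pow k).map φ
  have h2 : φ (X.openConeHom F F ^ k) = ψ (X.openConeHom F F ^ k) := by
    rw [map_pow, map_pow, h1]
  refine hu.mul_left_injective ?_
  change φ a * _ = ψ a * _
  conv_rhs => rw [h2]
  rw [← map_mul, ← map_mul, hg, h1]

theorem openCone_derivation_ext {M : Type*} [AddCommGroup M] [Module ℂ M]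
    [Module (X.openConeRing F) M] {d e : Derivation ℂ (X.openConeRing F) M}
    (h : ∀ i, d (X.openConeHom F (.X i)) = e (X.openConeHom F (.X i))) : d = e := by
  have h1 : ∀ g, d (X.openConeHom F g) = e (X.openConeHom F g) := fun g => by
    rw [derivation_aeval_eq_sum, derivation_aeval_eq_sum]
    simp only [h]
  ext a
  obtain ⟨k, g, hg⟩ := exists_mul_pow_eq_openConeHom a
  have h2 := h1 g
  rw [← hg, Derivation.leibniz, Derivation.leibniz, ← map_pow, h1, add_right_inj,
    map_pow] at h2
  exact (isUnit_openConeHom.pow k).smul_left_cancel.1 h2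

theorem exists_openCone_algHom {E : Type*} [CommRing E] [Algebra ℂ E]
    (ψ : MvPolynomial σ ℂ →ₐ[ℂ] E) (hψ : ∀ g ∈ X.ideal, ψ g = 0) (hF : IsUnit (ψ F)) :
    ∃ φ : X.openConeRing F →ₐ[ℂ] E, ∀ g, φ (X.openConeHom F g) = ψ g := by
  let ψ' : X.coordRing →ₐ[ℂ] E := Ideal.Quotient.liftₐ X.ideal ψ hψ
  have hu : ∀ y : Submonoid.powers (Ideal.Quotient.mk X.ideal F), IsUnit (ψ' y) := by
    rintro ⟨_, k, rfl⟩
    rw [map_pow]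
    exact hF.pow k
  refine ⟨IsLocalization.liftAlgHom (M := Submonoid.powers (Ideal.Quotient.mk X.ideal F))
    (f := ψ') hu, fun g => ?_⟩
  exact IsLocalization.lift_eq (g := (ψ' : X.coordRing →+* E)) hu (Ideal.Quotient.mk X.ideal g)

/-- The first-order Taylor expansion is multiplicative modulo the square of the increment. -/
theorem exists_algHom_dualNumbers {A : Type*} [CommRing A] [Algebra ℂ A]
    (T : MvPolynomial σ ℂ →ₐ[ℂ] A) (v : σ → A) :
    ∃ ψ : MvPolynomial σ ℂ →ₐ[ℂ] TrivSqZeroExt A A, (∀ g, (ψ g).fst = T g) ∧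
      ∀ g, (ψ g).snd = ∑ i, T (pderiv i g) * v i := by
  classical
  let ψ : MvPolynomial σ ℂ →ₐ[ℂ] TrivSqZeroExt A A := aeval fun i => .inl (T (.X i)) + .inr (v i)
  have hfst : ∀ g, (ψ g).fst = T g := fun g =>
    AlgHom.congr_fun (MvPolynomial.algHom_ext (f := (TrivSqZeroExt.fstHom ℂ A A).comp ψ) (g := T)
      (fun i => by simp [ψ])) g
  refine ⟨ψ, hfst, fun g => ?_⟩
  have hX : ∀ j, (ψ (.X j)).snd = v j := fun j => by simp [ψ]
  have hC : ∀ a, (ψ (C a)).snd = 0 := fun a => by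
    rw [show ψ (C a) = algebraMap ℂ _ a from ψ.commutes a, TrivSqZeroExt.algebraMap_eq_inl',
      TrivSqZeroExt.snd_inl]
  clear_value ψ
  induction g using MvPolynomial.induction_on with
  | C a => rw [hC]; simp
  | add p q hp hq =>
    rw [map_add, TrivSqZeroExt.snd_add, hp, hq]
    simp [add_mul, Finset.sum_add_distrib]
  | mul_X p j hp =>
    have h2 : ∀ i, T (pderiv i (p * .X j)) =
        T p * (if i = j then 1 else 0) + T (.X j) * T (pderiv i p) := by
      intro i
      rw [Derivation.leibniz, pderiv_X, Pi.single_apply, smul_eq_mul, smul_eq_mul, map_add,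
        map_mul, map_mul]
      simp only [eq_comm, apply_ite T, map_one, map_zero]
    simp only [map_mul, TrivSqZeroExt.snd_mul, hp, hfst, hX, h2, op_smul_eq_smul, smul_eq_mul,
      add_mul, Finset.sum_add_distrib, mul_assoc, ← Finset.mul_sum, ite_mul, one_mul,
      zero_mul, Finset.sum_ite_eq', Finset.mem_univ, if_true]

theorem exists_derivation_of_dualNumbers {A : Type*} [CommRing A] [Algebra ℂ A]
    (φ : A →ₐ[ℂ] TrivSqZeroExt A A) (h : ∀ a, (φ a).fst = a) :
    ∃ δ : Derivation ℂ A A, ∀ a, δ a = (φ a).snd := by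
  refine ⟨Derivation.mk' ((TrivSqZeroExt.sndHom A A).restrictScalars ℂ ∘ₗ φ.toLinearMap)
    fun a b => ?_, fun a => rfl⟩
  change (φ (a * b)).snd = a • (φ b).snd + b • (φ a).snd
  rw [map_mul, TrivSqZeroExt.snd_mul, h, h, op_smul_eq_smul]

/-- A polynomial vector field that is tangent to the cone induces a derivation. It is constructed
as a homomorphism to the ring of dual numbers. -/
theorem exists_openCone_derivation (u : σ → MvPolynomial σ ℂ)
    (hu : ∀ g ∈ X.ideal, ∑ i, u i * pderiv i g ∈ X.ideal) :
    ∃ δ : Derivation ℂ (X.openConeRing F) (X.openConeRing F),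
      ∀ g, δ (X.openConeHom F g) = X.openConeHom F (∑ i, u i * pderiv i g) := by
  have hsum : ∀ g, ∑ i, X.openConeHom F (pderiv i g) * X.openConeHom F (u i) =
      X.openConeHom F (∑ i, u i * pderiv i g) := by
    intro g
    rw [map_sum]
    exact Finset.sum_congr rfl fun i _ => by rw [map_mul, mul_comm]
  obtain ⟨ψ, hfst, hsnd⟩ :=
    exists_algHom_dualNumbers (X.openConeHom F) fun i => X.openConeHom F (u i)
  obtain ⟨φ, hφ⟩ := exists_openCone_algHom (F := F) ψ
    (fun g hg => TrivSqZeroExt.ext ((hfst g).trans (openConeHom_eq_zero hg))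
      ((hsnd g).trans ((hsum g).trans (openConeHom_eq_zero (hu g hg)))))
    (TrivSqZeroExt.isUnit_iff_isUnit_fst.2 ((hfst F).symm ▸ isUnit_openConeHom))
  have hid : (TrivSqZeroExt.fstHom ℂ _ _).comp φ = AlgHom.id ℂ (X.openConeRing F) :=
    openCone_algHom_ext fun i => (congrArg TrivSqZeroExt.fst (hφ (.X i))).trans (hfst (.X i))
  obtain ⟨δ, hδ⟩ := exists_derivation_of_dualNumbers φ (AlgHom.congr_fun hid)
  exact ⟨δ, fun g => by rw [hδ, hφ, hsnd, hsum]⟩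

/-! ### Points of the open part of the cone -/

theorem exists_algHom_of_mem_cone {x : σ → ℂ} (hx : x ∈ X.cone) (hxF : eval x F ≠ 0) :
    ∃ ρ : X.openConeRing F →ₐ[ℂ] ℂ, ∀ g, ρ (X.openConeHom F g) = eval x g := by
  obtain ⟨ρ, hρ⟩ := exists_openCone_algHom (X := X) (F := F) (aeval x)
    (fun g hg => by rw [aeval_eq_eval]; exact (X.mem_ideal_iff g).1 hg x hx)
    (by rw [aeval_eq_eval]; exact IsUnit.mk0 _ hxF)
  exact ⟨ρ, fun g => by rw [hρ, aeval_eq_eval]⟩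

theorem algHom_openConeHom_eq_eval (ρ : X.openConeRing F →ₐ[ℂ] ℂ) (g : MvPolynomial σ ℂ) :
    ρ (X.openConeHom F g) = eval (fun i => ρ (X.openConeHom F (.X i))) g := by
  have := AlgHom.congr_fun (MvPolynomial.algHom_ext (f := ρ.comp (X.openConeHom F))
    (g := aeval fun i => ρ (X.openConeHom F (.X i))) (fun i => by simp)) g
  simpa [aeval_eq_eval] using this

theorem mem_cone_of_algHom (ρ : X.openConeRing F →ₐ[ℂ] ℂ) :
    (fun i => ρ (X.openConeHom F (.X i))) ∈ X.cone :=
  X.mem_cone_of_forall_eval_eq_zero fun g hg => by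
    rw [← algHom_openConeHom_eq_eval, openConeHom_eq_zero hg, map_zero]

theorem eval_ne_zero_of_algHom (ρ : X.openConeRing F →ₐ[ℂ] ℂ) :
    eval (fun i => ρ (X.openConeHom F (.X i))) F ≠ 0 := by
  rw [← algHom_openConeHom_eq_eval]
  exact (isUnit_openConeHom.map ρ).ne_zero

/-- A form of the Nullstellensatz. -/
theorem exists_algHom_of_isMaximal {A : Type*} [CommRing A] [Algebra ℂ A] [Algebra.FiniteType ℂ A]
    (𝔪 : Ideal A) (h𝔪 : 𝔪.IsMaximal) : ∃ ρ : A →ₐ[ℂ] ℂ, ∀ a ∈ 𝔪, ρ a = 0 := by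
  let _ : Field (A ⧸ 𝔪) := Ideal.Quotient.field 𝔪
  have : Module.Finite ℂ (A ⧸ 𝔪) := finite_of_finite_type_of_isJacobsonRing ℂ (A ⧸ 𝔪)
  have : Algebra.IsAlgebraic ℂ (A ⧸ 𝔪) := Algebra.IsAlgebraic.of_finite ℂ (A ⧸ 𝔪)
  let ρ : (A ⧸ 𝔪) →ₐ[ℂ] ℂ := IsAlgClosed.lift
  exact ⟨ρ.comp (Ideal.Quotient.mkₐ ℂ 𝔪), fun a ha => by
    rw [AlgHom.comp_apply, Ideal.Quotient.mkₐ_eq_mk, Ideal.Quotient.eq_zero_iff_mem.2 ha, map_zero]⟩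

theorem derivation_openConeHom {M : Type*} [AddCommGroup M] [Module ℂ M]
    [Module (X.openConeRing F) M] (d : Derivation ℂ (X.openConeRing F) M)
    (g : MvPolynomial σ ℂ) : d (X.openConeHom F g) =
      ∑ i, X.openConeHom F (pderiv i g) • d (X.openConeHom F (.X i)) :=
  derivation_aeval_eq_sum _ d g

open Classical KaehlerDifferential in
/-- At each point of a smooth cone there is a frame of derivations that spans the tangent
space. -/
theorem SmoothCone.exists_isFrame (hF : F ∉ X.ideal) (hX : X.SmoothCone F) {x : σ → ℂ}
    (hx : x ∈ X.cone) (hxF : eval x F ≠ 0) :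
    ∃ (m : MvPolynomial σ ℂ) (I : Finset σ)
      (δ : σ → Derivation ℂ (X.openConeRing F) (X.openConeRing F)), eval x m ≠ 0 ∧
      IsFrame (fun i => X.openConeHom F (.X i)) (X.openConeHom F m) I δ ∧
      ∀ ρ : X.openConeRing F →ₐ[ℂ] ℂ, (∀ g, ρ (X.openConeHom F g) = eval x g) →
        ∀ w ∈ X.coneTangentSpace x, eval x m • w =
          ∑ b ∈ I, w b • fun i => ρ (δ b (X.openConeHom F (.X i))) := by
  obtain ⟨m, I, u, hm, huI, hu, hdet⟩ := hX.exists_tangent_fields hF hx hxF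
  have hex : ∀ b, ∃ δ : Derivation ℂ (X.openConeRing F) (X.openConeRing F), b ∈ I →
      ∀ g, δ (X.openConeHom F g) = X.openConeHom F (∑ i, u b i * pderiv i g) := by
    intro b
    by_cases hb : b ∈ I
    · obtain ⟨δ, hδ⟩ := exists_openCone_derivation (F := F) (u b) (hu b hb)
      exact ⟨δ, fun _ => hδ⟩
    · exact ⟨0, fun h => absurd h hb⟩
  choose δ hδ using hex
  have hδX : ∀ b ∈ I, ∀ i, δ b (X.openConeHom F (.X i)) = X.openConeHom F (u b i) := by
    intro b hb i
    rw [hδ b hb]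
    congr 1
    rw [Finset.sum_eq_single i]
    · simp
    · intro j _ hj
      simp [pderiv_X, Ne.symm hj]
    · simp
  refine ⟨m, I, δ, hm, ⟨fun b hb => ?_, fun b hb c hc hbc => ?_, fun y => ?_⟩, fun ρ hρ w hw => ?_⟩
  · rw [hδX b hb, huI b b hb, if_pos rfl]
  · rw [hδX b hb, huI b c hc, if_neg hbc, map_zero]
  · let A := X.openConeRing F
    let e : Derivation ℂ A (Ω[A⁄ℂ]) := ∑ b ∈ I,
      (LinearMap.toSpanSingleton A _ (D ℂ A (X.openConeHom F (.X b)))).compDer (δ b)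
    have he : ∀ y, e y = ∑ b ∈ I, δ b y • D ℂ A (X.openConeHom F (.X b)) := by
      intro y
      simp only [e]
      rw [← Derivation.coeFnAddMonoidHom_apply, map_sum, Finset.sum_apply]
      rfl
    have hext : X.openConeHom F m • D ℂ A = e := by
      refine openCone_derivation_ext fun i => ?_
      rw [he, Derivation.smul_apply]
      refine (hdet A (Ω[A⁄ℂ]) (X.openConeHom F : MvPolynomial σ ℂ →+* A)
        (fun i => D ℂ A (X.openConeHom F (.X i))) (fun g hg => ?_) i).trans
        (Finset.sum_congr rfl fun b hb => ?_)
      · have := derivation_openConeHom (D ℂ A) g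
        rw [openConeHom_eq_zero hg, map_zero] at this
        exact this.symm
      · rw [hδX b hb]
        rfl
    rw [← he, ← hext, Derivation.smul_apply]
  · ext i
    have h1 := hdet ℂ ℂ (eval x) w (fun g hg => by
      have := X.mem_coneTangentSpace.1 hw g hg
      rw [differential_apply] at this
      simpa using this) i
    rw [Pi.smul_apply, h1, Finset.sum_apply]
    refine Finset.sum_congr rfl fun b hb => ?_
    rw [Pi.smul_apply, hδX b hb, hρ, smul_eq_mul, smul_eq_mul, mul_comm]

theorem SmoothCone.hasFrames (hF : F ∉ X.ideal) (hX : X.SmoothCone F) :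
    HasFrames fun i => X.openConeHom F (.X i) := by
  intro 𝔪 h𝔪
  obtain ⟨ρ, hρ⟩ := exists_algHom_of_isMaximal 𝔪 h𝔪
  obtain ⟨m, I, δ, hm, hI, -⟩ := hX.exists_isFrame hF (mem_cone_of_algHom ρ)
    (eval_ne_zero_of_algHom ρ)
  rw [← algHom_openConeHom_eq_eval] at hm
  exact ⟨_, I, δ, fun h => hm (hρ _ h), hI⟩

/-! ### The scheme of critical points -/

variable (X F) in
/-- The contraction of a derivation with the logarithmic differential of `F`. -/
def contractLog : Derivation ℂ (X.openConeRing F) (X.openConeRing F) →ₗ[X.openConeRing F]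
    X.openConeRing F where
  toFun δ := IsLocalization.Away.invSelf (Ideal.Quotient.mk X.ideal F) * δ (X.openConeHom F F)
  map_add' δ ε := by rw [Derivation.add_apply, mul_add]
  map_smul' a δ := by
    rw [Derivation.smul_apply, smul_eq_mul, RingHom.id_apply, smul_eq_mul, mul_left_comm]

theorem derivation_linearForm (δ : Derivation ℂ (X.openConeRing F) (X.openConeRing F))
    (S : σ → ℂ) : δ (X.openConeHom F (linearForm S)) =
      ∑ i, S i • δ (X.openConeHom F (.X i)) := by
  have h : ∀ i, X.openConeHom F (C (S i) * .X i) = S i • X.openConeHom F (.X i) := by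
    intro i
    rw [← smul_eq_C_mul, map_smul]
  simp [linearForm, h, map_sum]

theorem critIdeal_linearForm (S : σ → ℂ) : X.critIdeal F (linearForm S) =
    zeroIdeal (X.contractLog F) (fun i => X.openConeHom F (.X i)) S := by
  rw [critIdeal, zeroIdeal]
  congr 2
  ext δ
  rw [← derivation_linearForm]
  rfl

theorem algHom_contractLog (ρ : X.openConeRing F →ₐ[ℂ] ℂ)
    (δ : Derivation ℂ (X.openConeRing F) (X.openConeRing F)) (η : MvPolynomial σ ℂ) :
    ρ (X.contractLog F δ - δ (X.openConeHom F η)) =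
      differential F (fun i => ρ (X.openConeHom F (.X i)))
          (fun i => ρ (δ (X.openConeHom F (.X i)))) /
        eval (fun i => ρ (X.openConeHom F (.X i))) F -
      differential η (fun i => ρ (X.openConeHom F (.X i)))
          (fun i => ρ (δ (X.openConeHom F (.X i)))) := by
  have h1 : ∀ g, ρ (δ (X.openConeHom F g)) = differential g
      (fun i => ρ (X.openConeHom F (.X i))) (fun i => ρ (δ (X.openConeHom F (.X i)))) := by
    intro g
    rw [derivation_openConeHom, differential_apply, map_sum]
    refine Finset.sum_congr rfl fun i _ => ?_
    rw [smul_eq_mul, map_mul, algHom_openConeHom_eq_eval]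
  have h2 : ρ (IsLocalization.Away.invSelf (Ideal.Quotient.mk X.ideal F)) =
      (eval (fun i => ρ (X.openConeHom F (.X i))) F)⁻¹ := by
    rw [← algHom_openConeHom_eq_eval]
    refine eq_inv_of_mul_eq_one_right ?_
    rw [← map_mul]
    have := IsLocalization.Away.mul_invSelf (S := X.openConeRing F) (Ideal.Quotient.mk X.ideal F)
    rw [show X.openConeHom F F = algebraMap _ _ (Ideal.Quotient.mk X.ideal F) from rfl, this,
      map_one]
  rw [map_sub, h1, contractLog]
  change ρ (_ * _) - _ = _
  rw [map_mul, h1, h2, div_eq_inv_mul]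

/-- The critical points are the points of the scheme of critical points. -/
theorem SmoothCone.encard_critLogMinus (hF : F ∉ X.ideal) (hX : X.SmoothCone F)
    (η : MvPolynomial σ ℂ) :
    (X.critLogMinus F η).encard = ENat.card (X.critRing F η →ₐ[ℂ] ℂ) := by
  let pt : (X.openConeRing F →ₐ[ℂ] ℂ) → σ → ℂ := fun ρ i => ρ (X.openConeHom F (.X i))
  have hmem : ∀ ρ : X.openConeRing F →ₐ[ℂ] ℂ,
      pt ρ ∈ X.critLogMinus F η ↔ ∀ a ∈ X.critIdeal F η, ρ a = 0 := by
    intro ρ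
    constructor
    · rintro ⟨-, -, h⟩
      have hle : X.critIdeal F η ≤ RingHom.ker ρ := by
        rw [critIdeal, Ideal.span_le]
        rintro _ ⟨δ, rfl⟩
        refine (algHom_contractLog ρ δ η).trans (h _ ?_)
        rw [mem_coneTangentSpace]
        intro g hg
        rw [differential_apply]
        have h1 := congrArg ρ (derivation_openConeHom δ g)
        rw [openConeHom_eq_zero hg, map_zero, map_zero, map_sum] at h1
        rw [h1]
        refine Finset.sum_congr rfl fun i _ => ?_
        rw [smul_eq_mul, map_mul, algHom_openConeHom_eq_eval]
      exact hle
    · intro h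
      refine ⟨mem_cone_of_algHom ρ, eval_ne_zero_of_algHom ρ, fun w hw => ?_⟩
      obtain ⟨m, I, δ, hm, -, hspan⟩ := hX.exists_isFrame hF (mem_cone_of_algHom ρ)
        (eval_ne_zero_of_algHom ρ)
      have hw' := hspan ρ (algHom_openConeHom_eq_eval ρ) w hw
      let Λ : (σ → ℂ) →ₗ[ℂ] ℂ :=
        (eval (pt ρ) F)⁻¹ • differential F (pt ρ) - differential η (pt ρ)
      have hΛ : ∀ v, Λ v = differential F (pt ρ) v / eval (pt ρ) F - differential η (pt ρ) v := by
        intro v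
        simp [Λ, div_eq_inv_mul]
      change differential F (pt ρ) w / eval (pt ρ) F - differential η (pt ρ) w = 0
      rw [← hΛ]
      have h2 := congrArg Λ hw'
      rw [map_smul, map_sum, Finset.sum_eq_zero, smul_eq_zero] at h2
      · exact h2.resolve_left hm
      · intro b _
        rw [map_smul, hΛ, ← algHom_contractLog ρ (δ b) η, smul_eq_zero]
        exact Or.inr (h _ (Ideal.subset_span ⟨δ b, rfl⟩))
  let Φ : (X.critRing F η →ₐ[ℂ] ℂ) → X.critLogMinus F η := fun f =>
    ⟨pt (f.comp (Ideal.Quotient.mkₐ ℂ _)), (hmem _).2 fun a ha => by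
      rw [AlgHom.comp_apply, Ideal.Quotient.mkₐ_eq_mk, Ideal.Quotient.eq_zero_iff_mem.2 ha,
        map_zero]⟩
  have hΦ : Function.Bijective Φ := by
    constructor
    · intro f g hfg
      have h1 : f.comp (Ideal.Quotient.mkₐ ℂ (X.critIdeal F η)) =
          g.comp (Ideal.Quotient.mkₐ ℂ (X.critIdeal F η)) :=
        openCone_algHom_ext fun i => congrFun (congrArg Subtype.val hfg) i
      refine AlgHom.ext fun y => ?_
      obtain ⟨a, rfl⟩ := Ideal.Quotient.mk_surjective y
      exact AlgHom.congr_fun h1 a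
    · rintro ⟨x, hx⟩
      obtain ⟨ρ, hρ⟩ := exists_algHom_of_mem_cone hx.1 hx.2.1
      have hpt : pt ρ = x := funext fun i => (hρ _).trans (eval_X i)
      have hker := (hmem ρ).1 (hpt ▸ hx)
      refine ⟨Ideal.Quotient.liftₐ _ ρ hker, Subtype.ext ?_⟩
      exact hpt
  rw [← ENat.card_coe_set_eq, ENat.card_congr (Equiv.ofBijective Φ hΦ)]

/-- The number of critical points of `log F - η` on a smooth cone is the same for all generic
linear forms `η`, and the scheme of critical points is reduced. -/
theorem SmoothCone.exists_encard_critLogMinus (hF : F ∉ X.ideal) (hX : X.SmoothCone F) :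
    ∃ d : ℕ, ForGeneric fun S : σ → ℂ => (X.critLogMinus F (linearForm S)).encard = d ∧
      IsReduced (X.critRing F (linearForm S)) := by
  have := isDomain_openConeRing hF
  obtain ⟨d, h, hh, hd⟩ := (hX.hasFrames hF).exists_card_zeros (X.contractLog F)
  refine ⟨d, h, hh, fun S hS => ?_⟩
  have h1 : IsReduced _ ∧ _ := hd S hS
  rw [← critIdeal_linearForm] at h1
  exact ⟨(hX.encard_critLogMinus hF _).trans h1.2, h1.1⟩

end ProjVariety

/-! ### Generic linear forms and projective critical points -/

theorem ForGeneric.and {σ : Type} {P Q : (σ → ℂ) → Prop} (hP : ForGeneric P) (hQ : ForGeneric Q) :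
    ForGeneric fun S => P S ∧ Q S := by
  obtain ⟨g, hg, hgP⟩ := hP
  obtain ⟨h, hh, hhQ⟩ := hQ
  refine ⟨g * h, mul_ne_zero hg hh, fun S hS => ?_⟩
  rw [map_mul] at hS
  exact ⟨hgP S (left_ne_zero_of_mul hS), hhQ S (right_ne_zero_of_mul hS)⟩

theorem ForGeneric.mono {σ : Type} {P Q : (σ → ℂ) → Prop} (hP : ForGeneric P)
    (h : ∀ S, P S → Q S) : ForGeneric Q := by
  obtain ⟨g, hg, hgP⟩ := hP
  exact ⟨g, hg, fun S hS => h S (hgP S hS)⟩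

theorem ForGeneric.of_forall {σ : Type} {P : (σ → ℂ) → Prop} (h : ∀ S, P S) : ForGeneric P :=
  ⟨1, one_ne_zero, fun S _ => h S⟩

theorem ForGeneric.ball_finite {σ ι : Type} {t : Set ι} (ht : t.Finite)
    {P : ι → (σ → ℂ) → Prop} (h : ∀ i ∈ t, ForGeneric (P i)) :
    ForGeneric fun S => ∀ i ∈ t, P i S := by
  induction t, ht using Set.Finite.induction_on with
  | empty => exact .of_forall fun S i hi => absurd hi (Set.notMem_empty i)
  | @insert a s _ _ ih =>
    refine ((h a (Set.mem_insert a s)).and (ih fun i hi => h i (Set.mem_insert_of_mem a hi))).mono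
      fun S hS i hi => ?_
    rcases Set.mem_insert_iff.1 hi with rfl | hi
    · exact hS.1
    · exact hS.2 i hi

/-- Genericity is invariant under rescaling of the coordinates. -/
theorem ForGeneric.comp_mul {σ : Type} {P : (σ → ℂ) → Prop} (hP : ForGeneric P) {c : σ → ℂ}
    (hc : ∀ i, c i ≠ 0) : ForGeneric fun S => P (c * S) := by
  obtain ⟨g, hg, hgP⟩ := hP
  have hev : ∀ S, eval S (bind₁ (fun i => C (c i) * X i) g) = eval (c * S) g := by
    intro S
    rw [← aeval_eq_eval, ← aeval_eq_eval, aeval_bind₁]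
    congr 2
    ext i
    simp
  refine ⟨bind₁ (fun i => C (c i) * X i) g, fun h0 => hg (funext fun S => ?_), fun S hS =>
    hgP _ (by rwa [← hev])⟩
  have h1 := hev (c⁻¹ * S)
  rw [h0, map_zero, ← mul_assoc, show c * c⁻¹ = 1 from _root_.funext fun i =>
    mul_inv_cancel₀ (hc i), one_mul] at h1
  rw [← h1, map_zero]

section LinearForm

variable {σ : Type} [Fintype σ]

theorem eval_linearForm (S x : σ → ℂ) : eval x (linearForm S) = ∑ i, S i * x i := by
  simp [linearForm]

theorem isHomogeneous_linearForm (S : σ → ℂ) : (linearForm S).IsHomogeneous 1 :=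
  IsHomogeneous.sum _ _ _ fun i _ => by
    simpa using (isHomogeneous_C σ (S i)).mul (isHomogeneous_X ℂ i)

theorem differential_linearForm (S x v : σ → ℂ) :
    ProjVariety.differential (linearForm S) x v = eval v (linearForm S) := by
  classical
  rw [differential_apply, eval_linearForm]
  refine Finset.sum_congr rfl fun i _ => ?_
  congr 1
  simp only [linearForm, map_sum, pderiv_C_mul, pderiv_X]
  rw [Finset.sum_eq_single i]
  · simp
  · intro j _ hj
    simp [hj]
  · simp

/-- A generic linear form does not vanish at a given point other than the origin. -/
theorem forGeneric_eval_linearForm_ne_zero {y : σ → ℂ} (hy : y ≠ 0) :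
    ForGeneric fun S => eval y (linearForm S) ≠ 0 := by
  classical
  obtain ⟨i, hi⟩ := Function.ne_iff.1 hy
  refine ⟨linearForm y, fun h0 => hi ?_, fun S hS => ?_⟩
  · have h1 := eval_linearForm y (Pi.single i 1)
    rw [h0, map_zero] at h1
    simpa [Pi.single_apply] using h1.symm
  · rw [eval_linearForm] at hS ⊢
    simpa only [mul_comm] using hS

/-- A generic linear form does not lie in a given prime ideal other than the irrelevant ideal. -/
theorem forGeneric_linearForm_notMem {P : Ideal (MvPolynomial σ ℂ)} (hP : P.IsPrime) {i : σ}
    (hi : X i ∉ P) : ForGeneric fun S => linearForm S ∉ P := by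
  obtain ⟨y, hy, hyi⟩ : ∃ y, (∀ g ∈ P, eval y g = 0) ∧ y i ≠ 0 := by
    by_contra! h
    refine hi ?_
    rw [← IsPrime.vanishingIdeal_zeroLocus (k := ℂ) (K := ℂ) P, mem_vanishingIdeal_iff]
    intro y hy
    rw [aeval_X]
    exact h y fun g hg => by simpa [aeval_eq_eval] using hy g hg
  exact (forGeneric_eval_linearForm_ne_zero (y := y) fun h => hyi (by rw [h]; rfl)).mono
    fun S hS h => hS (hy _ h)

end LinearForm

namespace ProjVariety

variable {σ : Type} [Fintype σ]

theorem differential_sub (g h : MvPolynomial σ ℂ) (x v : σ → ℂ) :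
    differential (g - h) x v = differential g x v - differential h x v := by
  simp [differential_apply, sub_mul]

theorem differential_mul (g h : MvPolynomial σ ℂ) (x v : σ → ℂ) :
    differential (g * h) x v = eval x g * differential h x v + eval x h * differential g x v := by
  simp only [differential_apply, Derivation.leibniz, map_add, smul_eq_mul, map_mul, add_mul,
    Finset.sum_add_distrib, mul_assoc, Finset.mul_sum]

theorem differential_pow (g : MvPolynomial σ ℂ) (k : ℕ) (x v : σ → ℂ) :
    differential (g ^ k) x v = k * eval x g ^ (k - 1) * differential g x v := by
  simp only [differential_apply, Derivation.leibniz_pow, smul_eq_mul, map_mul, nsmul_eq_mul,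
    map_pow, map_natCast, Finset.mul_sum, mul_assoc]

theorem differential_smul_of_isHomogeneous {g : MvPolynomial σ ℂ} {d : ℕ}
    (hg : g.IsHomogeneous d) (a : ℂ) (x v : σ → ℂ) :
    differential g (a • x) v = a ^ (d - 1) * differential g x v := by
  simp only [differential_apply, Finset.mul_sum]
  refine Finset.sum_congr rfl fun i _ => ?_
  rw [eval_smul_of_isHomogeneous hg.pderiv, mul_assoc]

theorem differential_self_of_isHomogeneous {g : MvPolynomial σ ℂ} {d : ℕ}
    (hg : g.IsHomogeneous d) (x : σ → ℂ) : differential g x x = d * eval x g := by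
  have h := congrArg (eval x) hg.sum_X_mul_pderiv
  rw [map_sum, nsmul_eq_mul, map_mul, map_natCast] at h
  rw [← h, differential_apply]
  exact Finset.sum_congr rfl fun i _ => by rw [map_mul, eval_X, mul_comm]

theorem differential_eq_sum_homogeneousComponent (g : MvPolynomial σ ℂ) (x v : σ → ℂ) :
    differential g x v = ∑ d ∈ Finset.range (g.totalDegree + 1),
      differential (homogeneousComponent d g) x v := by
  simp only [differential_apply]
  rw [Finset.sum_comm]
  refine Finset.sum_congr rfl fun i _ => ?_
  rw [← Finset.sum_mul, ← map_sum, ← map_sum, sum_homogeneousComponent]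

variable (X : ProjVariety σ)

/-- The line through a point of the cone lies in the cone. -/
theorem self_mem_coneTangentSpace {x : σ → ℂ} (hx : x ∈ X.cone) : x ∈ X.coneTangentSpace x := by
  rw [mem_coneTangentSpace]
  intro g hg
  rw [differential_eq_sum_homogeneousComponent]
  refine Finset.sum_eq_zero fun d _ => ?_
  rw [differential_self_of_isHomogeneous (homogeneousComponent_isHomogeneous d g),
    (X.mem_ideal_iff _).1 (X.homogeneousComponent_mem_ideal hg d) x hx, mul_zero]

theorem coneTangentSpace_le_smul (x : σ → ℂ) (a : ℂ) :
    X.coneTangentSpace x ≤ X.coneTangentSpace (a • x) := by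
  intro v hv
  rw [mem_coneTangentSpace] at hv ⊢
  intro g hg
  rw [differential_eq_sum_homogeneousComponent]
  refine Finset.sum_eq_zero fun d _ => ?_
  rw [differential_smul_of_isHomogeneous (homogeneousComponent_isHomogeneous d g),
    hv _ (X.homogeneousComponent_mem_ideal hg d), mul_zero]

theorem coneTangentSpace_smul (x : σ → ℂ) {a : ℂ} (ha : a ≠ 0) :
    X.coneTangentSpace (a • x) = X.coneTangentSpace x := by
  refine le_antisymm ?_ (X.coneTangentSpace_le_smul x a)
  have := X.coneTangentSpace_le_smul (a • x) a⁻¹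
  rwa [smul_smul, inv_mul_cancel₀ ha, one_smul] at this

variable {X} {F : MvPolynomial σ ℂ} {N : ℕ}

theorem ne_zero_of_eval_ne_zero (hFN : F.IsHomogeneous N) (hN : N ≠ 0) {x : σ → ℂ}
    (hx : eval x F ≠ 0) : x ≠ 0 := by
  rintro rfl
  have := eval_smul_of_isHomogeneous hFN 0 0
  rw [zero_smul, zero_pow hN, zero_mul] at this
  exact hx this

theorem SmoothAwayFrom.smoothCone (hX : X.SmoothAwayFrom F) (hFN : F.IsHomogeneous N)
    (hN : N ≠ 0) : X.SmoothCone F := by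
  have key : ∀ x ∈ X.cone, eval x F ≠ 0 →
      ((Module.finrank ℂ (X.coneTangentSpace x) : ℕ) : WithBot ℕ∞) = ringKrullDim X.coordRing := by
    intro x hx hxF
    have hx0 := ne_zero_of_eval_ne_zero hFN hN hxF
    obtain ⟨a, ha⟩ := Projectivization.exists_smul_eq_mk_rep ℂ x hx0
    have h := hX _ (hx hx0)
    rw [SmoothAt, ← ha, Units.smul_def, eval_smul_of_isHomogeneous hFN,
      coneTangentSpace_smul X x a.ne_zero] at h
    exact h (mul_ne_zero (pow_ne_zero _ a.ne_zero) hxF)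
  intro x hx y hy hxF hyF
  exact_mod_cast (key x hx hxF).trans (key y hy hyF).symm

/-! ### Critical points on the cone and on the projective variety -/

variable (X) in
/-- The point `x` is critical for `log (F / ℓ ^ N)`. This does not change when `x` is rescaled. -/
def IsCritQuotient (F ℓ : MvPolynomial σ ℂ) (N : ℕ) (x : σ → ℂ) : Prop :=
  eval x F ≠ 0 ∧ eval x ℓ ≠ 0 ∧ ∀ v ∈ X.coneTangentSpace x,
    differential F x v / eval x F - N * (differential ℓ x v / eval x ℓ) = 0

theorem IsCritQuotient.smul (hFN : F.IsHomogeneous N) (hN : N ≠ 0) {S x : σ → ℂ}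
    (hx : X.IsCritQuotient F (linearForm S) N x) {a : ℂ} (ha : a ≠ 0) :
    X.IsCritQuotient F (linearForm S) N (a • x) := by
  obtain ⟨hxF, hxℓ, h⟩ := hx
  rw [IsCritQuotient, eval_smul_of_isHomogeneous hFN,
    eval_smul_of_isHomogeneous (isHomogeneous_linearForm S), coneTangentSpace_smul X x ha]
  refine ⟨mul_ne_zero (pow_ne_zero _ ha) hxF, mul_ne_zero (pow_ne_zero _ ha) hxℓ, fun v hv => ?_⟩
  have h1 := h v hv
  rw [differential_smul_of_isHomogeneous hFN,
    differential_smul_of_isHomogeneous (isHomogeneous_linearForm S)]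
  obtain ⟨k, rfl⟩ := Nat.exists_eq_succ_of_ne_zero hN
  have h2 : a ^ (k + 1 - 1) * differential F x v / (a ^ (k + 1) * eval x F) -
      ((k + 1 : ℕ) : ℂ) * (a ^ (1 - 1) * differential (linearForm S) x v /
        (a ^ 1 * eval x (linearForm S))) =
      a⁻¹ * (differential F x v / eval x F -
        ((k + 1 : ℕ) : ℂ) * (differential (linearForm S) x v / eval x (linearForm S))) := by
    rw [Nat.add_sub_cancel, Nat.sub_self, pow_zero, pow_one, pow_succ]
    field_simp
  rw [Nat.succ_eq_add_one] at h1 ⊢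
  rw [h2, h1, mul_zero]

/-- The critical points of `log F - ℓ` are the critical points of `log (F / ℓ ^ N)`, normalized
by `ℓ x = N`. This normalization holds by Euler's identity. -/
theorem mem_critLogMinus_iff (hFN : F.IsHomogeneous N) (hN : N ≠ 0) {S x : σ → ℂ} :
    x ∈ X.critLogMinus F (linearForm S) ↔ x ∈ X.cone ∧
      X.IsCritQuotient F (linearForm S) N x ∧ eval x (linearForm S) = N := by
  have hN' : (N : ℂ) ≠ 0 := Nat.cast_ne_zero.2 hN
  constructor
  · rintro ⟨hx, hxF, h⟩
    have hℓ : eval x (linearForm S) = N := by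
      have h1 := h x (X.self_mem_coneTangentSpace hx)
      rw [differential_self_of_isHomogeneous hFN, differential_linearForm,
        mul_div_cancel_right₀ _ hxF] at h1
      exact (sub_eq_zero.1 h1).symm
    refine ⟨hx, ⟨hxF, hℓ ▸ hN', fun v hv => ?_⟩, hℓ⟩
    rw [hℓ, mul_div_cancel₀ _ hN']
    exact h v hv
  · rintro ⟨hx, ⟨hxF, -, h⟩, hℓ⟩
    refine ⟨hx, hxF, fun v hv => ?_⟩
    have h1 := h v hv
    rwa [hℓ, mul_div_cancel₀ _ hN'] at h1

theorem encard_isCritQuotient (hFN : F.IsHomogeneous N) (hN : N ≠ 0) (S : σ → ℂ) :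
    {p | p ∈ X.carrier ∧ X.IsCritQuotient F (linearForm S) N p.rep}.encard =
      (X.critLogMinus F (linearForm S)).encard := by
  have hN' : (N : ℂ) ≠ 0 := Nat.cast_ne_zero.2 hN
  -- the representative of a point that is normalized by `ℓ x = N`
  let ψ : ℙ ℂ (σ → ℂ) → σ → ℂ := fun p => (N / eval p.rep (linearForm S)) • p.rep
  have hψ : ∀ p, eval p.rep (linearForm S) ≠ 0 → ∃ h0 : ψ p ≠ 0, Projectivization.mk ℂ (ψ p) h0 = p := by
    intro p hp
    have ha := div_ne_zero hN' hp
    refine ⟨smul_ne_zero ha p.rep_nonzero, ?_⟩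
    conv_rhs => rw [← p.mk_rep]
    exact (Projectivization.mk_eq_mk_iff' ℂ _ _ _ _).2 ⟨_, rfl⟩
  have hinj : Set.InjOn ψ {p | p ∈ X.carrier ∧ X.IsCritQuotient F (linearForm S) N p.rep} := by
    rintro p ⟨-, -, hp, -⟩ q ⟨-, -, hq, -⟩ hpq
    obtain ⟨h0, h1⟩ := hψ p hp
    obtain ⟨h0', h1'⟩ := hψ q hq
    rw [← h1, ← h1']
    congr 1
  rw [← hinj.encard_image]
  congr 1
  ext x
  rw [mem_critLogMinus_iff hFN hN]
  constructor
  · rintro ⟨p, ⟨hp, hcrit⟩, rfl⟩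
    refine ⟨X.smul_mem_cone (X.rep_mem_cone hp) _, hcrit.smul hFN hN (div_ne_zero hN' hcrit.2.1),
      ?_⟩
    rw [eval_smul_of_isHomogeneous (isHomogeneous_linearForm S), pow_one,
      div_mul_cancel₀ _ hcrit.2.1]
  · rintro ⟨hx, hcrit, hℓ⟩
    have hx0 := ne_zero_of_eval_ne_zero hFN hN hcrit.1
    obtain ⟨a, ha⟩ := Projectivization.exists_smul_eq_mk_rep ℂ x hx0
    refine ⟨Projectivization.mk ℂ x hx0, ⟨hx hx0, ?_⟩, ?_⟩
    · rw [← ha]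
      exact hcrit.smul hFN hN a.ne_zero
    · simp only [ψ]
      rw [← ha, Units.smul_def, eval_smul_of_isHomogeneous (isHomogeneous_linearForm S), hℓ,
        smul_smul, pow_one]
      have : (N : ℂ) / (a * N) * a = 1 := by
        have := a.ne_zero
        field_simp
      rw [this, one_smul]

variable (X F) in
/-- The linear form `ℓ` does not vanish on the projective variety, nor on any of the components of
its intersection with the hypersurface `F = 0`. -/
def IsTransversalForm (ℓ : MvPolynomial σ ℂ) : Prop :=
  ℓ ∉ X.ideal ∧ ∀ P ∈ (X.ideal ⊔ Ideal.span {F}).minimalPrimes, (∃ i, MvPolynomial.X i ∉ P) → ℓ ∉ P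

variable (X F) in
theorem forGeneric_isTransversalForm :
    ForGeneric fun S : σ → ℂ => X.IsTransversalForm F (linearForm S) := by
  refine ForGeneric.and ?_ (ForGeneric.ball_finite
    (Ideal.finite_minimalPrimes_of_isNoetherianRing _ _) fun P hP => ?_)
  · obtain ⟨p, hp⟩ := X.nonempty
    exact (forGeneric_eval_linearForm_ne_zero p.rep_nonzero).mono fun S hS h =>
      hS ((X.mem_ideal_iff _).1 h _ (X.rep_mem_cone hp))
  · by_cases hi : ∃ i, MvPolynomial.X i ∉ P
    · obtain ⟨i, hi⟩ := hi
      exact (forGeneric_linearForm_notMem hP.1.1 hi).mono fun S hS _ => hS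
    · exact .of_forall fun S h => absurd h hi

theorem mul_sub_mul_mem_ideal {a b a' b' : MvPolynomial σ ℂ} (hb : b ∉ X.ideal)
    (hb' : b' ∉ X.ideal)
    (h : X.toConeField a / X.toConeField b = X.toConeField a' / X.toConeField b') :
    a * b' - a' * b ∈ X.ideal := by
  rw [← toConeField_eq_zero_iff] at hb hb' ⊢
  rw [div_eq_div_iff hb hb'] at h
  rw [map_sub, map_mul, map_mul, h, sub_self]

theorem notMem_ideal_of_eval_ne_zero {p : ℙ ℂ (σ → ℂ)} (hp : p ∈ X.carrier)
    {g : MvPolynomial σ ℂ} (hg : eval p.rep g ≠ 0) : g ∉ X.ideal :=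
  fun h => hg ((X.mem_ideal_iff g).1 h _ (X.rep_mem_cone hp))

/-- A critical point of `log (F / ℓ ^ N)` does not lie on the hypersurface `F = 0`: otherwise a
local equation `a * ℓ ^ N = b * F`, with `a` not zero at the point, would show that `ℓ` vanishes on
a component of `F = 0` through the point. -/
theorem IsCritLog.eval_ne_zero {ℓ : MvPolynomial σ ℂ} (hℓ : X.IsTransversalForm F ℓ)
    {p : ℙ ℂ (σ → ℂ)}
    (hp : X.IsCritLog (X.toConeField F / X.toConeField (ℓ ^ N)) p) : eval p.rep F ≠ 0 := by
  obtain ⟨hpX, d, a, b, -, -, hab, ha, hb, -⟩ := hp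
  intro hF
  have hℓN : ℓ ^ N ∉ X.ideal := fun h => hℓ.1 (X.ideal_isPrime.mem_of_pow_mem N h)
  have hrel := mul_sub_mul_mem_ideal hℓN (notMem_ideal_of_eval_ne_zero hpX hb) hab
  let 𝔪 : Ideal (MvPolynomial σ ℂ) := RingHom.ker (eval p.rep)
  have : 𝔪.IsPrime := RingHom.ker_isPrime _
  have hle : X.ideal ⊔ Ideal.span {F} ≤ 𝔪 := by
    refine sup_le (fun g hg => (X.mem_ideal_iff g).1 hg _ (X.rep_mem_cone hpX)) ?_
    rw [Ideal.span_singleton_le_iff_mem]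
    exact hF
  obtain ⟨P, hP, hPm⟩ := Ideal.exists_minimalPrimes_le hle
  have hPprime : P.IsPrime := hP.1.1
  have hFP : F ∈ P := hP.1.2 (Ideal.mem_sup_right (Ideal.mem_span_singleton_self F))
  have haP : a * ℓ ^ N ∈ P := by
    have h1 := P.sub_mem (P.mul_mem_right b hFP) (hP.1.2 (Ideal.mem_sup_left hrel))
    rwa [sub_sub_cancel] at h1
  have hℓP : ℓ ∈ P := hPprime.mem_of_pow_mem N
    ((hPprime.mem_or_mem haP).resolve_left fun h => ha (hPm h))
  obtain ⟨i, hi⟩ := Function.ne_iff.1 p.rep_nonzero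
  exact hℓ.2 P hP ⟨i, fun h => hi (by simpa [𝔪] using hPm h)⟩ hℓP

/-- The critical points of the rational function can be computed with the representation
`F / ℓ ^ N`. -/
theorem isCritLog_iff {S : σ → ℂ} (hFN : F.IsHomogeneous N) (hN : N ≠ 0)
    (hℓ : X.IsTransversalForm F (linearForm S)) (p : ℙ ℂ (σ → ℂ)) :
    X.IsCritLog (X.toConeField F / X.toConeField (linearForm S ^ N)) p ↔
      p ∈ X.carrier ∧ X.IsCritQuotient F (linearForm S) N p.rep := by
  set ℓ := linearForm S
  have hpow : ∀ v, eval p.rep ℓ ≠ 0 → differential (ℓ ^ N) p.rep v / eval p.rep (ℓ ^ N) =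
      N * (differential ℓ p.rep v / eval p.rep ℓ) := by
    intro v hne
    obtain ⟨k, rfl⟩ := Nat.exists_eq_succ_of_ne_zero hN
    rw [differential_pow, map_pow, Nat.succ_eq_add_one, Nat.add_sub_cancel, pow_succ]
    field_simp
  constructor
  · intro hp
    have hF := hp.eval_ne_zero hℓ
    obtain ⟨hpX, d, a, b, -, -, hab, ha, hb, h⟩ := hp
    have hℓN : ℓ ^ N ∉ X.ideal := fun h => hℓ.1 (X.ideal_isPrime.mem_of_pow_mem N h)
    have hrel := mul_sub_mul_mem_ideal hℓN (notMem_ideal_of_eval_ne_zero hpX hb) hab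
    have hval := (X.mem_ideal_iff _).1 hrel _ (X.rep_mem_cone hpX)
    rw [map_sub, map_mul, map_mul, sub_eq_zero] at hval
    have hℓN0 : eval p.rep (ℓ ^ N) ≠ 0 := by
      intro h0
      rw [h0, mul_zero] at hval
      exact mul_ne_zero hF hb hval
    have hℓ0 : eval p.rep ℓ ≠ 0 := fun h0 => hℓN0 (by rw [map_pow, h0, zero_pow hN])
    refine ⟨hpX, hF, hℓ0, fun v hv => ?_⟩
    have h1 := X.mem_coneTangentSpace.1 hv _ hrel
    rw [differential_sub, differential_mul, differential_mul] at h1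
    have h2 := h v hv
    rw [← hpow v hℓ0]
    -- differentiate the relation `F * b = a * ℓ ^ N` logarithmically
    generalize eval p.rep (ℓ ^ N) = L at *
    generalize differential (ℓ ^ N) p.rep v = dL at *
    generalize eval p.rep F = f at *
    generalize eval p.rep a = α at *
    generalize eval p.rep b = β at *
    have h3 : differential F p.rep v / f - dL / L =
        (differential a p.rep v / α - differential b p.rep v / β) := by
      have hL : L = f * β / α := by
        field_simp
        linear_combination -hval
      rw [hL] at h1 ⊢
      field_simp at h1 ⊢
      linear_combination h1
    rw [h3, h2]
  · rintro ⟨hpX, hF, hℓ0, h⟩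
    refine ⟨hpX, N, F, ℓ ^ N, hFN, ?_, rfl, hF, ?_, fun v hv => ?_⟩
    · simpa using (isHomogeneous_linearForm S).pow N
    · rw [map_pow]
      exact pow_ne_zero N hℓ0
    · rw [hpow v hℓ0]
      exact h v hv

/-- A point where `a` and `b` do not vanish is not in the support of the divisor of `a / b`,
because `a / b` is a unit in the local rings. -/
theorem notMem_divSupport {a b : MvPolynomial σ ℂ} {d : ℕ} (ha : a.IsHomogeneous d)
    (hb : b.IsHomogeneous d) {p : ℙ ℂ (σ → ℂ)} (hpa : eval p.rep a ≠ 0) (hpb : eval p.rep b ≠ 0) :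
    p ∉ X.divSupport (X.toConeField a / X.toConeField b) := by
  rintro ⟨Z, hZ, ⟨f, g, hf, hg, hfg, hord⟩, hpZ⟩
  have haZ := notMem_ideal_of_eval_ne_zero hpZ hpa
  have hbZ := notMem_ideal_of_eval_ne_zero hpZ hpb
  have ha0 : X.toConeField a ≠ 0 := fun h =>
    haZ (X.ideal_mono hZ.1 ((X.toConeField_eq_zero_iff a).1 h))
  have hb0 : X.toConeField b ≠ 0 := fun h =>
    hbZ (X.ideal_mono hZ.1 ((X.toConeField_eq_zero_iff b).1 h))
  have hg0 : (g : X.coneField) ≠ 0 := fun h => hg (Subtype.ext h)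
  let u : X.localRing Z hZ.1 := ⟨X.toConeField a / X.toConeField b, d, a, b, ha, hb, hbZ, rfl⟩
  let w : X.localRing Z hZ.1 := ⟨X.toConeField b / X.toConeField a, d, b, a, hb, ha, haZ, rfl⟩
  have huw : u * w = 1 := by
    refine Subtype.ext ?_
    change X.toConeField a / X.toConeField b * (X.toConeField b / X.toConeField a) = 1
    field_simp
  have hfu : f = g * u := by
    refine Subtype.ext ?_
    change (f : X.coneField) = g * (X.toConeField a / X.toConeField b)
    rw [hfg]
    field_simp
  have hassoc : Associated g f := by
    rw [hfu]
    exact associated_mul_unit_right g u (IsUnit.of_mul_eq_one w huw)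
  refine hord ?_
  rw [Ring.ord, Ring.ord, Ideal.span_singleton_eq_span_singleton.2 hassoc]

theorem encard_critLog_eq {S : σ → ℂ} (hFN : F.IsHomogeneous N) (hN : N ≠ 0)
    (hℓ : X.IsTransversalForm F (linearForm S)) :
    {p | p ∈ X.carrier \ X.divSupport (X.toConeField F / X.toConeField (linearForm S ^ N)) ∧
      X.IsCritLog (X.toConeField F / X.toConeField (linearForm S ^ N)) p}.encard =
      (X.critLogMinus F (linearForm S)).encard := by
  rw [← encard_isCritQuotient hFN hN]
  congr 1
  ext p
  rw [Set.mem_ofPred_eq, isCritLog_iff hFN hN hℓ]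
  refine ⟨fun h => h.2, fun h => ⟨⟨h.1, notMem_divSupport hFN ?_ h.2.1 ?_⟩, h⟩⟩
  · simpa using (isHomogeneous_linearForm S).pow N
  · rw [map_pow]
    exact pow_ne_zero N h.2.2.1

/-! ### Varieties inside the hypersurface -/

theorem critLogMinus_eq_empty (hF : F ∈ X.ideal) (η : MvPolynomial σ ℂ) :
    X.critLogMinus F η = ∅ :=
  Set.eq_empty_of_forall_notMem fun x hx => hx.2.1 ((X.mem_ideal_iff F).1 hF x hx.1)

theorem isReduced_critRing (hF : F ∈ X.ideal) (η : MvPolynomial σ ℂ) :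
    IsReduced (X.critRing F η) := by
  have hu := isUnit_openConeHom (X := X) (F := F)
  rw [openConeHom_eq_zero hF, isUnit_zero_iff] at hu
  have : Subsingleton (X.openConeRing F) := subsingleton_of_zero_eq_one hu
  have : Subsingleton (X.critRing F η) := Ideal.Quotient.mk_surjective.subsingleton
  infer_instance

theorem not_isCritLog (hF : F ∈ X.ideal) (g : MvPolynomial σ ℂ) (p : ℙ ℂ (σ → ℂ)) :
    ¬X.IsCritLog (X.toConeField F / X.toConeField g) p := by
  rintro ⟨hpX, d, a, b, -, -, hab, ha, hb, -⟩
  have h1 := (X.toConeField_eq_zero_iff a).not.2 (notMem_ideal_of_eval_ne_zero hpX ha)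
  have h2 := (X.toConeField_eq_zero_iff b).not.2 (notMem_ideal_of_eval_ne_zero hpX hb)
  rw [(X.toConeField_eq_zero_iff F).2 hF, zero_div] at hab
  exact div_ne_zero h1 h2 hab.symm

end ProjVariety

/-! ### The determinant and the trace form -/

theorem isHomogeneous_detPoly (n : ℕ) : (detPoly n).IsHomogeneous n := by
  rw [detPoly, Matrix.det_apply]
  refine IsHomogeneous.sum _ _ _ fun π _ => ?_
  have h : (∏ i, symMatrix (X : Sym2 (Fin n) → MvPolynomial (Sym2 (Fin n)) ℂ) (π i) i).IsHomogeneous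
      (∑ _i : Fin n, 1) := IsHomogeneous.prod _ _ _ fun i _ => isHomogeneous_X ℂ _
  rw [Finset.sum_const, Finset.card_univ, Fintype.card_fin, smul_eq_mul, mul_one] at h
  exact (homogeneousSubmodule (Sym2 (Fin n)) ℂ n).smul_of_tower_mem (Equiv.Perm.sign π) h

/-- The number of positions of a coordinate in a symmetric matrix: one on the diagonal, and two
off the diagonal. -/
def sym2Weight {n : ℕ} (z : Sym2 (Fin n)) : ℂ :=
  ((Finset.univ.filter fun q : Fin n × Fin n => s(q.1, q.2) = z).card : ℂ)

theorem sym2Weight_ne_zero {n : ℕ} (z : Sym2 (Fin n)) : sym2Weight z ≠ 0 := by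
  induction z using Sym2.ind with
  | _ i j =>
    rw [sym2Weight, Nat.cast_ne_zero]
    exact Finset.card_ne_zero_of_mem (a := (i, j)) (by simp)

theorem traceForm_eq_linearForm {n : ℕ} (S : Sym2 (Fin n) → ℂ) :
    traceForm S = linearForm (sym2Weight * S) := by
  have h1 : traceForm S = ∑ q : Fin n × Fin n, C (S s(q.1, q.2)) * X s(q.1, q.2) := by
    rw [Fintype.sum_prod_type]
    simp only [traceForm, Matrix.trace, Matrix.diag, Matrix.mul_apply, symMatrix, Matrix.map_apply,
      Matrix.of_apply]
    refine Finset.sum_congr rfl fun i _ => Finset.sum_congr rfl fun j _ => ?_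
    rw [Sym2.eq_swap (a := j)]
  rw [h1, linearForm, ← Finset.sum_fiberwise Finset.univ fun q : Fin n × Fin n => s(q.1, q.2)]
  refine Finset.sum_congr rfl fun z _ => ?_
  rw [Finset.sum_congr rfl (g := fun _ => C (S z) * X z) fun q hq => by
    rw [(Finset.mem_filter.1 hq).2], Finset.sum_const]
  simp [sym2Weight, mul_assoc, nsmul_eq_mul]

end MLDeg

end

theorem mainTheorem3 (n : ℕ) (X : MLDeg.ProjVariety (Sym2 (Fin n)))
    (hX : X.SmoothAwayFrom (MLDeg.detPoly n)) :
    ∃ d : ℕ, MLDeg.IsGaussianMLDegree X d ∧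
      MLDeg.ForGeneric fun S : Sym2 (Fin n) → ℂ =>
        {p | p ∈ X.carrier \ X.divSupport (MLDeg.gaussianRatFun X S) ∧
          X.IsCritLog (MLDeg.gaussianRatFun X S) p}.encard = d := by
  by_cases hF : MLDeg.detPoly n ∈ X.ideal
  -- if `X` lies in `V(det)`, there are no critical points of either kind
  · refine ⟨0, .of_forall fun S => ⟨?_, MLDeg.ProjVariety.isReduced_critRing hF _⟩,
      .of_forall fun S => ?_⟩
    · rw [MLDeg.ProjVariety.critLogMinus_eq_empty hF]
      simp
    · rw [Nat.cast_zero, Set.encard_eq_zero]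
      exact Set.eq_empty_of_forall_notMem fun p hp =>
        MLDeg.ProjVariety.not_isCritLog hF _ p hp.2
  · have hn : n ≠ 0 := by
      rintro rfl
      obtain ⟨p, -⟩ := X.nonempty
      exact p.rep_nonzero (Subsingleton.elim _ _)
    have hdet := MLDeg.isHomogeneous_detPoly n
    obtain ⟨d, hd⟩ := (hX.smoothCone hdet hn).exists_encard_critLogMinus hF
    have hd' := hd.comp_mul MLDeg.sym2Weight_ne_zero
    have htr := (MLDeg.ProjVariety.forGeneric_isTransversalForm X (MLDeg.detPoly n)).comp_mul
      MLDeg.sym2Weight_ne_zero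
    refine ⟨d, hd'.mono fun S hS => ?_, (hd'.and htr).mono fun S hS => ?_⟩
    · rw [MLDeg.traceForm_eq_linearForm]
      exact hS
    · rw [MLDeg.gaussianRatFun, MLDeg.traceForm_eq_linearForm,
        MLDeg.ProjVariety.encard_critLog_eq hdet hn hS.2]
      exact hS.1.1
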